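/- **Setting.** Fix integers $a\ge 2$ and $b\ge 2a$, a linearly ordered set of keys, a set of values and a set of threads. The OCC-ABtree is a concurrent dictionary stored as a relaxed $(a,b)$-tree below a permanent sentinel node. Leaves have $b$ slots, each of which is empty or holds a key with a value, and a version counter; internal nodes have immutable routing keys $k_1<\dots<k_m$ and $m+1$ changeable child pointers; tagged nodes are internal nodes that represent a temporary height imbalance. Every node has a mark, set when the node is unlinked, and an MCS lock, i.e. a FIFO queue of threads whose head holds the lock. Initially the tree is an empty leaf. Threads invoke $\mathrm{find}(k)$, $\mathrm{insert}(k,v)$, $\mathrm{delete}(k)$; steps of different threads interleave arbitrarily. * Searches go from the sentinel down by routing keys and take no locks; a leaf is scanned between two reads of its version, and the scan is repeated unless both reads give the same even value. * A $\mathrm{delete}$ that finds its key locks the leaf and empties the slot; if the leaf now has fewer than $a$ keys, it then calls $\mathrm{fixUnderfull}$ on it. An $\mathrm{insert}$ that does not find its key locks the leaf and fills an empty slot. If there is none, it also locks the parent and replaces the leaf by a new tagged node (an ordinary internal node if it becomes the root) with two new leaves, and then calls $\mathrm{fixTagged}$ on a tagged node so created. The version is incremented just before and just after a change of a slot. * $\mathrm{fixTagged}$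 searches for the node and locks the node, its parent and its grandparent. It replaces node and parent by one new internal node or, if that would have more than $b$ children, by a new node with two new internal children; in the latter case the new node is tagged, unless it becomes the root, and $\mathrm{fixTagged}$ is called on it if tagged. * $\mathrm{fixUnderfull}$ does nothing on the sentinel or the root. Otherwise it searches for the node, reads the adjacent sibling (the left one, if there is one), and locks node and sibling from left to right, then parent, then grandparent. It replaces node, sibling and parent by new nodes in which the contents of node and sibling are shared evenly (if their total size is at least $2a$) or merged; after merging it calls $\mathrm{fixUnderfull}$ on the merged node and on the new parent, unless the merged node replaces a root with two children. * After locking, an update that finds one of its nodes marked, or a precondition violated (parent tagged in $\mathrm{fixTagged}$; parent underfull, or node, sibling or parent tagged in $\mathrm{fixUnderfull}$), releases its locks and starts again with a new search. All locks are released before an operation returns, retries or calls a rebalancing step. *Variants.* In the Elim-ABtree each leaf also records the key, value and version of the last modification of one of its slots; $\mathrm{insert}$ and $\mathrm{delete}$ scan the leaf only once and then repeatedly try either to return on the basis of a consistently read record or to obtain the leaf's lock by a non-blocking attempt. In the persistent p-OCC-ABtree and p-Elim-ABtree a new child pointer is written with a "not yet persistent" mark, flushed and then unmarked before any lock is released,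 and searches wait at pointers so marked; values and keys are flushed when they are written; words may also reach persistent memory at any other time; and the system may crash at any time, after which the persistent contents survive, all operations are lost, and locks, marks, versions, sizes and elimination records are reset. A thread *waits* at a node $n$ if it is in the queue of the lock of $n$ but not at its head, or spins until that lock is free, or spins until the version of $n$ is even, or waits until a child pointer in $n$ has been flushed. It then waits *for* the thread that holds the lock of $n$ and for every thread ahead of it in the lock queue of $n$. A *deadlock* is a nonempty set of threads each of which waits for a thread of the set, or waits at a node whose lock nobody holds. **Claim.** For the OCC-ABtree, the Elim-ABtree, the p-OCC-ABtree and the p-Elim-ABtree, in every (finite or infinite) execution: 1. No configuration contains a deadlock; in every configuration every thread that holds a lock is executing an operation; and in every configuration every thread that is executing an operation and is not waiting can take a step. 2. There is a single strict total order $\prec$ on the nodes, fixed for the whole execution, such that $x\prec y$ whenever at some time $x$ is a child of $y$ (bottom to top), or $x$ and $y$ are children of the same node with $x$ to the left of $y$ (left to right); and all lock acquisitions follow it: whenever a thread acquires the lock of $n$ while holding the lock of $m$, then $m\prec n$. 3. The relative order of parent and child, and of siblings, never changes: if at some time $x$ is a child of $y$ or a sibling to the left of $y$, then at no time of the execution is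 $y$ a child of $x$ or a sibling to the left of $x$. -/

import Mathlib

/-!  A model of the OCC-ABtree and of its variants as a transition system over a shared memory.  -/

namespace OCCABtree

/-- Parameters: minimum and maximum node size, and which variant is meant.  `elim` switches on
publishing elimination (Elim-ABtree), `persist` switches on persistence (p-OCC-ABtree); both
together give the p-Elim-ABtree, neither gives the OCC-ABtree. -/
structure Params where
  a : ℕ
  b : ℕ
  elim : Bool
  persist : Bool

/-! ### Shared memory -/

inductive Kind where
  | leaf
  | internal
  | tagged
  deriving DecidableEq

/-- Record of the last simple insert or successful delete that modified a leaf. -/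
structure ElimRec (K V : Type*) where
  key : K
  val : Option V
  ver : ℕ

/-- A node.  Node references are natural numbers.  `keys` and `vals` are the slots of a leaf,
`rkeys` and `ptrs` the routing keys and child pointers of an internal (or tagged) node.
`size` counts the keys of a leaf and the child pointers of any other node.

`queue` is the MCS lock: the queue of the threads that requested it, oldest first; the head holds
the lock.

`dirty i` is the mark on the `i`-th child pointer that says that it has not been flushed yet, and
`pptrs`, `pkeys`, `pvals` are the contents of persistent memory (used in persistent variants). -/
structure Node (K V T : Type*) where
  kind : Kind
  searchKey : K
  rkeys : List K
  ptrs : List ℕ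
  dirty : ℕ → Bool
  keys : ℕ → Option K
  vals : ℕ → Option V
  size : ℕ
  marked : Bool
  ver : ℕ
  elimRec : Option (ElimRec K V)
  queue : List T
  pptrs : List ℕ
  pkeys : ℕ → Option K
  pvals : ℕ → Option V

/-- The sentinel node. -/
abbrev entry : ℕ := 0

/-! ### Local state of the threads -/

/-- What a thread is executing: an operation of the dictionary or a rebalancing step.
`ret` is the value that the surrounding operation returns in the end, and `rest` lists the nodes
for which `fixUnderfull` is to be called afterwards. -/
inductive Task (K V : Type*) where
  | find (k : K)
  | insert (k : K) (v : V)
  | delete (k : K)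
  | fixTagged (n : ℕ) (ret : Option V)
  | fixUnderfull (n : ℕ) (rest : List ℕ) (ret : Option V)

/-- The dictionary operations, as opposed to rebalancing steps. -/
def Task.IsOperation {K V : Type*} : Task K V → Prop
  | .find _ => True
  | .insert _ _ => True
  | .delete _ => True
  | _ => False

/-- Target node of the search of a task (`none` is NULL). -/
def Task.target {K V : Type*} : Task K V → Option ℕ
  | .fixTagged n _ => some n
  | .fixUnderfull n _ _ => some n
  | _ => none

/-- Search state and search result, together with the key that is searched for. -/
structure Path (K : Type*) where
  key : K
  gp : Option ℕ
  p : Option ℕ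
  pIdx : ℕ
  n : ℕ
  nIdx : ℕ

/-- Index of the sibling that `fixUnderfull` uses. -/
def Path.sibIdx {K : Type*} (π : Path K) : ℕ := if π.nIdx = 0 then 1 else π.nIdx - 1

/-- A word of memory that is persisted. -/
inductive Loc where
  | key (n i : ℕ)
  | val (n i : ℕ)
  | ptr (n i : ℕ)

/-- Single accesses to shared memory.  Acquiring a lock is `request` (enter the queue) followed by
`await` (wait until at the head of the queue). -/
inductive Instr (K V : Type*) where
  | request (n : ℕ)
  | await (n : ℕ)
  | unlock (n : ℕ)
  | bumpVer (n : ℕ)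
  | setRec (n : ℕ) (r : ElimRec K V)
  | setKey (n i : ℕ) (k : Option K)
  | setVal (n i : ℕ) (v : Option V)
  | setSize (n s : ℕ)
  | setMarked (n : ℕ)
  | setPtr (n i m : ℕ) (dirty : Bool)
  | flush (l : Loc)
  | clearDirty (n i : ℕ)

/-- Program counter and local variables of a thread.

* `idle res`: no operation in progress, the last one returned `res` (`none` is `⊥`);
* `enter`, `retry`: at the beginning of the code of a task, at its label RETRY;
* `search`: in the loop of `search`, at node `π.n`;
* `leafVer`, `leafScan`, `leafVal`, `leafCheck`: in the scan of the leaf `π.n`: about to read the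
  version, slot `i` of `keys`, slot `i` of `vals`, and the version again;
* `elimStart`, `elimVer1`, `elimRead`, `elimVer2`, `tryLock`: in `lockOrElim`;
* `readSibling`: in `fixUnderfull`, about to read the pointer to the sibling;
* `run is next`: executing the straight-line code `is`, then `next`;
* `locked`: holding the leaf (`insert`, `delete`) or all the nodes of the rebalancing step;
* `lockedParent`: in `insert`, holding the leaf and its parent. -/
inductive Local (K V : Type*) where
  | idle (res : Option V)
  | enter (τ : Task K V)
  | retry (τ : Task K V)
  | search (τ : Task K V) (π : Path K)
  | leafVer (τ : Task K V) (π : Path K)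
  | leafScan (τ : Task K V) (π : Path K) (v₁ i : ℕ)
  | leafVal (τ : Task K V) (π : Path K) (v₁ i : ℕ)
  | leafCheck (τ : Task K V) (π : Path K) (v₁ : ℕ) (found : Option V)
  | elimStart (τ : Task K V) (π : Path K)
  | elimVer1 (τ : Task K V) (π : Path K) (startVer : ℕ)
  | elimRead (τ : Task K V) (π : Path K) (startVer v₁ : ℕ)
  | elimVer2 (τ : Task K V) (π : Path K) (startVer v₁ : ℕ) (r : Option (ElimRec K V))
  | tryLock (τ : Task K V) (π : Path K) (startVer : ℕ)
  | readSibling (τ : Task K V) (π : Path K)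
  | run (is : List (Instr K V)) (next : Local K V)
  | locked (τ : Task K V) (π : Path K) (sib : Option ℕ)
  | lockedParent (τ : Task K V) (π : Path K)

/-- A configuration.  The nodes allocated so far are those below `next`. -/
structure Config (K V T : Type*) where
  heap : ℕ → Node K V T
  next : ℕ
  threads : T → Local K V

section Memory

variable {K V T : Type*}

/-- A new leaf with the given contents; `d` is its search key if it has no key. -/
def mkLeaf (d : K) (l : List (K × Option V)) : Node K V T where
  kind := .leaf
  searchKey := (l.head?.map Prod.fst).getD d
  rkeys := []
  ptrs := []
  dirty := fun _ => false
  keys := fun i => l[i]?.map Prod.fst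
  vals := fun i => l[i]?.bind Prod.snd
  size := l.length
  marked := false
  ver := 0
  elimRec := none
  queue := []
  pptrs := []
  pkeys := fun i => l[i]?.map Prod.fst
  pvals := fun i => l[i]?.bind Prod.snd

/-- A new internal or tagged node; `d` is its search key if it has no routing key. -/
def mkInternal (kind : Kind) (d : K) (ks : List K) (ps : List ℕ) : Node K V T where
  kind := kind
  searchKey := ks.head?.getD d
  rkeys := ks
  ptrs := ps
  dirty := fun _ => false
  keys := fun _ => none
  vals := fun _ => none
  size := ps.length
  marked := false
  ver := 0
  elimRec := none
  queue := []
  pptrs := ps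
  pkeys := fun _ => none
  pvals := fun _ => none

/-- The initial configuration: the sentinel, whose only child is an empty leaf; no operation is in
progress. -/
def Config.init (k₀ : K) : Config K V T where
  heap := fun n => if n = entry then mkInternal .internal k₀ [] [1] else mkLeaf k₀ []
  next := 2
  threads := fun _ => .idle none

/-- Change one node. -/
def Config.modify (c : Config K V T) (n : ℕ) (f : Node K V T → Node K V T) : Config K V T :=
  { c with heap := Function.update c.heap n (f (c.heap n)) }

/-- Change the local state of one thread. -/
def Config.goto [DecidableEq T] (c : Config K V T) (t : T) (l : Local K V) : Config K V T :=
  { c with threads := Function.update c.threads t l }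

/-- Allocate new nodes; they get the references `c.next`, `c.next + 1`, ...  In persistent variants
they are flushed before they are linked, so their persistent contents are set here, too. -/
def Config.alloc (c : Config K V T) (l : List (Node K V T)) : Config K V T :=
  { c with
    heap := fun n => if n < c.next then c.heap n else l[n - c.next]?.getD (c.heap n)
    next := c.next + l.length }

/-- The current value of a word reaches persistent memory. -/
def Config.flush (c : Config K V T) : Loc → Config K V T
  | .key n i => c.modify n fun x => { x with pkeys := Function.update x.pkeys i (x.keys i) }
  | .val n i => c.modify n fun x => { x with pvals := Function.update x.pvals i (x.vals i) }
  | .ptr n i => c.modify n fun x => { x with pptrs := (x.ptrs[i]?).elim x.pptrs (x.pptrs.set i) }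

/-- A node after a crash and recovery: the persistent contents survive, all other fields are
reset. -/
def Node.recover (P : Params) (x : Node K V T) : Node K V T :=
  { x with
    ptrs := x.pptrs
    keys := x.pkeys
    vals := x.pvals
    dirty := fun _ => false
    size := match x.kind with
      | .leaf => ((List.range P.b).filter fun i => (x.pkeys i).isSome).length
      | _ => x.pptrs.length
    marked := false
    ver := 0
    elimRec := none
    queue := [] }

/-- A system crash followed by the recovery procedure. -/
def Config.recover (P : Params) (c : Config K V T) : Config K V T :=
  { c with heap := fun n => (c.heap n).recover P, threads := fun _ => .idle none }

/-- Effect of a memory access of thread `t`. -/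
def Instr.exec (t : T) (c : Config K V T) : Instr K V → Config K V T
  | .request n => c.modify n fun x => { x with queue := x.queue ++ [t] }
  | .await _ => c
  | .unlock n => c.modify n fun x => { x with queue := x.queue.tail }
  | .bumpVer n => c.modify n fun x => { x with ver := x.ver + 1 }
  | .setRec n r => c.modify n fun x => { x with elimRec := some r }
  | .setKey n i k => c.modify n fun x => { x with keys := Function.update x.keys i k }
  | .setVal n i v => c.modify n fun x => { x with vals := Function.update x.vals i v }
  | .setSize n s => c.modify n fun x => { x with size := s }
  | .setMarked n => c.modify n fun x => { x with marked := true }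
  | .setPtr n i m d => c.modify n fun x =>
      { x with ptrs := x.ptrs.set i m, dirty := Function.update x.dirty i d }
  | .flush l => c.flush l
  | .clearDirty n i => c.modify n fun x => { x with dirty := Function.update x.dirty i false }

end Memory

section Program

variable {K V T : Type*} [LinearOrder K]

/-- Index of the child pointer that a search for `key` follows. -/
def Node.childIdx (x : Node K V T) (key : K) : ℕ := (x.rkeys.takeWhile (· ≤ key)).length

/-- First slot of a leaf that contains `o` (`none` is an empty slot). -/
def Node.findSlot (P : Params) (x : Node K V T) (o : Option K) : Option ℕ :=
  (List.range P.b).find? fun i => x.keys i = o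

/-- Contents of a leaf, in the order of the slots. -/
def Node.contents (P : Params) (x : Node K V T) : List (K × Option V) :=
  (List.range P.b).filterMap fun i => (x.keys i).map fun k => (k, x.vals i)

/-- Sort key-value pairs by their keys. -/
def sortPairs (l : List (K × Option V)) : List (K × Option V) :=
  l.insertionSort fun p q => p.1 ≤ q.1

/-- Two leaves that evenly share the given (sorted) contents, and the key between them. -/
def splitLeaf (d : K) (l : List (K × Option V)) : Node K V T × K × Node K V T :=
  let m := (l.length + 1) / 2
  (mkLeaf d (l.take m), ((l.drop m).head?.map Prod.fst).getD d, mkLeaf d (l.drop m))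

/-- Two internal nodes that evenly share the given routing keys and child pointers, and the key
between them. -/
def splitInternal (d : K) (ks : List K) (ps : List ℕ) : Node K V T × K × Node K V T :=
  let m := (ps.length + 1) / 2
  (mkInternal .internal d (ks.take (m - 1)) (ps.take m), ks[m - 1]?.getD d,
    mkInternal .internal d (ks.drop m) (ps.drop m))

/-- Acquire locks one after the other. -/
def lockSeq (ns : List ℕ) : List (Instr K V) := ns.flatMap fun n => [.request n, .await n]

/-- Release locks. -/
def unlockSeq (ns : List ℕ) : List (Instr K V) := ns.map .unlock

/-- Write a child pointer.  Persistent variants write it marked, flush it, and remove the mark. -/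
def linkScript (P : Params) (n i m : ℕ) : List (Instr K V) :=
  if P.persist then [.setPtr n i m true, .flush (.ptr n i), .clearDirty n i]
  else [.setPtr n i m false]

/-- Simple insert into the empty slot `i` of the locked leaf `n`, whose contents are `x`. -/
def insertScript (P : Params) (n : ℕ) (x : Node K V T) (i : ℕ) (k : K) (v : V) :
    List (Instr K V) :=
  [.bumpVer n]
  ++ (if P.elim then [.setRec n ⟨k, some v, x.ver + 1⟩] else [])
  ++ (if P.persist then
        [.setVal n i (some v), .flush (.val n i), .setKey n i (some k), .flush (.key n i)]
      else [.setKey n i (some k), .setVal n i (some v)])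
  ++ [.setSize n (x.size + 1), .bumpVer n, .unlock n]

/-- Successful delete of slot `i` of the locked leaf `n`, whose contents are `x`. -/
def deleteScript (P : Params) (n : ℕ) (x : Node K V T) (i : ℕ) (k : K) : List (Instr K V) :=
  [.bumpVer n]
  ++ (if P.elim then [.setRec n ⟨k, x.vals i, x.ver + 1⟩] else [])
  ++ [.setKey n i none]
  ++ (if P.persist then [.flush (.key n i)] else [])
  ++ [.setSize n (x.size - 1), .bumpVer n, .unlock n]

/-- The operation returns `ret`, after `fixUnderfull` was called for the nodes in `rest`. -/
def finish (rest : List ℕ) (ret : Option V) : Local K V :=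
  match rest with
  | [] => .idle ret
  | n :: rest' => .enter (.fixUnderfull n rest' ret)

/-- Return from a rebalancing step. -/
def Task.return : Task K V → Local K V
  | .fixTagged _ ret => .idle ret
  | .fixUnderfull _ rest ret => finish rest ret
  | _ => .idle none

/-- Begin of a search, at the sentinel. -/
def startSearch (τ : Task K V) (key : K) : Local K V :=
  .search τ ⟨key, none, none, 0, entry, 0⟩

/-- Code before the label RETRY. -/
def enterStep (c : Config K V T) (τ : Task K V) : Local K V :=
  match τ with
  | .fixUnderfull n _ _ =>
      if n = entry ∨ (c.heap entry).ptrs[0]? = some n then τ.return else .retry τ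
  | _ => .retry τ

/-- Code after the label RETRY, up to the call of `search`. -/
def retryStep (c : Config K V T) (τ : Task K V) : Local K V :=
  match τ with
  | .find k => startSearch τ k
  | .insert k _ => startSearch τ k
  | .delete k => startSearch τ k
  | .fixTagged n _ =>
      if (c.heap n).marked then τ.return else startSearch τ (c.heap n).searchKey
  | .fixUnderfull n _ _ => startSearch τ (c.heap n).searchKey

/-- The search has arrived at a leaf or at the target node. -/
def afterSearch (τ : Task K V) (π : Path K) : Local K V :=
  match τ with
  | .fixTagged n _ =>
      if π.n ≠ n then τ.return
      else match π.p, π.gp with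
        | some p, some gp => .run (lockSeq [π.n, p, gp]) (.locked τ π none)
        | _, _ => .retry τ
  | .fixUnderfull n _ _ => if π.n ≠ n then τ.return else .readSibling τ π
  | _ => .leafVer τ π

/-- The loop of `search` ends at this node. -/
def Node.endsSearch (x : Node K V T) (τ : Task K V) (n : ℕ) : Prop :=
  x.kind = .leaf ∨ τ.target = some n

instance (x : Node K V T) (τ : Task K V) (n : ℕ) : Decidable (x.endsSearch τ n) :=
  inferInstanceAs (Decidable (_ ∨ _))

/-- One iteration of the loop of `search`.  A marked pointer is not followed: the thread waits. -/
def searchStep (c : Config K V T) (τ : Task K V) (π : Path K) : Option (Local K V) :=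
  let x := c.heap π.n
  let i := x.childIdx π.key
  if x.endsSearch τ π.n then some (afterSearch τ π)
  else if x.dirty i then none
  else match x.ptrs[i]? with
    | some m => some (.search τ ⟨π.key, π.p, some π.n, π.nIdx, m, i⟩)
    | none => some (.retry τ)

/-- With elimination, `insert` and `delete` scan the leaf only once. -/
def scansOnce (P : Params) (τ : Task K V) : Bool :=
  P.elim && match τ with
    | .insert _ _ => true
    | .delete _ => true
    | _ => false

/-- Start to lock the leaf of an `insert` or `delete`. -/
def getLeaf (P : Params) (τ : Task K V) (π : Path K) : Local K V :=
  if P.elim then .elimStart τ π else .run (lockSeq [π.n]) (.locked τ π none)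

/-- Result of a consistent scan of a leaf. -/
def afterScan (P : Params) (τ : Task K V) (π : Path K) (found : Option V) : Local K V :=
  match τ with
  | .find _ => .idle found
  | .insert _ _ => if found.isSome then .idle found else getLeaf P τ π
  | .delete _ => if found.isSome then getLeaf P τ π else .idle none
  | _ => .retry τ

/-- What a thread does when it holds the locks it asked for: the nodes it creates, the
straight-line code that it executes, and the state that it continues in. -/
structure Plan (K V T : Type*) where
  new : List (Node K V T)
  code : List (Instr K V)
  next : Local K V

/-- `insert`, holding the leaf. -/
def planInsert (P : Params) (c : Config K V T) (k : K) (v : V) (π : Path K) : Plan K V T :=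
  let x := c.heap π.n
  if x.marked then ⟨[], [.unlock π.n], .retry (.insert k v)⟩
  else match x.findSlot P (some k) with
    | some i => ⟨[], [.unlock π.n], .idle (x.vals i)⟩
    | none => match x.findSlot P none with
      | some i => ⟨[], insertScript P π.n x i k v, .idle none⟩
      | none => match π.p with
        | some p => ⟨[], lockSeq [p], .lockedParent (.insert k v) π⟩
        | none => ⟨[], [.unlock π.n], .retry (.insert k v)⟩

/-- Splitting insert, holding the full leaf and its parent.  The new node that joins the two halves
is tagged, unless it is the new root. -/
def planSplit (P : Params) (c : Config K V T) (k : K) (v : V) (π : Path K) (p : ℕ) :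
    Plan K V T :=
  let x := c.heap π.n
  let m := c.next
  if (c.heap p).marked then ⟨[], unlockSeq [π.n, p], .retry (.insert k v)⟩
  else
    let (l, s, r) := splitLeaf k (sortPairs (x.contents P ++ [(k, some v)]))
    ⟨[l, r, mkInternal (if p = entry then .internal else .tagged) s [s] [m, m + 1]],
      linkScript P p π.nIdx (m + 2) ++ [.setMarked π.n] ++ unlockSeq [π.n, p],
      if p = entry then .idle none else .enter (.fixTagged (m + 2) none)⟩

/-- `delete`, holding the leaf. -/
def planDelete (P : Params) (c : Config K V T) (k : K) (π : Path K) : Plan K V T :=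
  let x := c.heap π.n
  if x.marked then ⟨[], [.unlock π.n], .retry (.delete k)⟩
  else match x.findSlot P (some k) with
    | none => ⟨[], [.unlock π.n], .idle none⟩
    | some i => ⟨[], deleteScript P π.n x i k,
        if x.size - 1 < P.a then .enter (.fixUnderfull π.n [] (x.vals i)) else .idle (x.vals i)⟩

/-- `fixTagged`, holding the node, its parent and its grandparent. -/
def planFixTagged (P : Params) (c : Config K V T) (n : ℕ) (ret : Option V) (π : Path K)
    (p gp : ℕ) : Plan K V T :=
  let x := c.heap n
  let y := c.heap p
  let m := c.next
  if x.marked ∨ y.marked ∨ (c.heap gp).marked ∨ y.kind = .tagged then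
    ⟨[], unlockSeq [n, p, gp], .retry (.fixTagged n ret)⟩
  else
    let ks := y.rkeys.take π.nIdx ++ x.rkeys ++ y.rkeys.drop π.nIdx
    let ps := y.ptrs.take π.nIdx ++ x.ptrs ++ y.ptrs.drop (π.nIdx + 1)
    if y.size + 1 ≤ P.b then
      ⟨[mkInternal .internal y.searchKey ks ps],
        [.setMarked n, .setMarked p] ++ linkScript P gp π.pIdx m ++ unlockSeq [n, p, gp],
        .idle ret⟩
    else
      let (l, s, r) := splitInternal y.searchKey ks ps
      ⟨[l, r, mkInternal (if gp = entry then .internal else .tagged) s [s] [m, m + 1]],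
        [.setMarked n, .setMarked p] ++ linkScript P gp π.pIdx (m + 2) ++ unlockSeq [n, p, gp],
        if gp = entry then .idle ret else .enter (.fixTagged (m + 2) ret)⟩

/-- The nodes that `fixUnderfull` locks, in this order: the node and its sibling from left to right
(if the parent has only one child there is no sibling), the parent, the grandparent. -/
def underfullLocks (π : Path K) (sib : Option ℕ) (p gp : ℕ) : List ℕ :=
  (if π.nIdx = 0 then π.n :: sib.toList else sib.toList ++ [π.n]) ++ [p, gp]

/-- `fixUnderfull`, holding the node, its sibling, parent and grandparent.  Here `j` and `j + 1`
are the indices of the left and the right one of the node and its sibling. -/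
def planFixUnderfull (P : Params) (c : Config K V T) (n : ℕ) (rest : List ℕ) (ret : Option V)
    (π : Path K) (sib : Option ℕ) (p gp : ℕ) : Plan K V T :=
  let locks := underfullLocks π sib p gp
  let x := c.heap n
  let y := c.heap p
  let m := c.next
  if P.a ≤ x.size then ⟨[], unlockSeq locks, finish rest ret⟩
  else match sib with
    | none => ⟨[], unlockSeq locks, .retry (.fixUnderfull n rest ret)⟩
    | some s =>
      let z := c.heap s
      if y.size < P.a ∨ x.marked ∨ z.marked ∨ y.marked ∨ (c.heap gp).marked
          ∨ x.kind = .tagged ∨ z.kind = .tagged ∨ y.kind = .tagged then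
        ⟨[], unlockSeq locks, .retry (.fixUnderfull n rest ret)⟩
      else
        let j := if π.nIdx = 0 then 0 else π.nIdx - 1
        let l := if π.nIdx = 0 then x else z
        let r := if π.nIdx = 0 then z else x
        let pairs := sortPairs (l.contents P ++ r.contents P)
        let ks := l.rkeys ++ (y.rkeys[j]?).toList ++ r.rkeys
        let ps := l.ptrs ++ r.ptrs
        let marks : List (Instr K V) := [.setMarked n, .setMarked p, .setMarked s]
        if 2 * P.a ≤ x.size + z.size then
          let (l', k', r') :=
            if x.kind = .leaf then splitLeaf l.searchKey pairs
            else splitInternal l.searchKey ks ps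
          ⟨[l', r', mkInternal .internal y.searchKey (y.rkeys.set j k')
              (y.ptrs.take j ++ [m, m + 1] ++ y.ptrs.drop (j + 2))],
            linkScript P gp π.pIdx (m + 2) ++ marks ++ unlockSeq locks,
            finish rest ret⟩
        else
          let x' := if x.kind = .leaf then mkLeaf l.searchKey pairs
            else mkInternal .internal l.searchKey ks ps
          if gp = entry ∧ y.size = 2 then
            ⟨[x'], linkScript P gp π.pIdx m ++ marks ++ unlockSeq locks, finish rest ret⟩
          else
            ⟨[x', mkInternal .internal y.searchKey (y.rkeys.eraseIdx j)
                (y.ptrs.take j ++ [m] ++ y.ptrs.drop (j + 2))],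
              linkScript P gp π.pIdx (m + 1) ++ marks ++ unlockSeq locks,
              .enter (.fixUnderfull m ((m + 1) :: rest) ret)⟩

/-- Plan of a thread in state `locked`. -/
def planLocked (P : Params) (c : Config K V T) (τ : Task K V) (π : Path K) (sib : Option ℕ) :
    Plan K V T :=
  match τ, π.p, π.gp with
  | .insert k v, _, _ => planInsert P c k v π
  | .delete k, _, _ => planDelete P c k π
  | .fixTagged n ret, some p, some gp => planFixTagged P c n ret π p gp
  | .fixUnderfull n rest ret, some p, some gp => planFixUnderfull P c n rest ret π sib p gp
  | _, _, _ => ⟨[], [], .retry τ⟩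

/-- Plan of a thread in state `lockedParent`. -/
def planLockedParent (P : Params) (c : Config K V T) (τ : Task K V) (π : Path K) : Plan K V T :=
  match τ, π.p with
  | .insert k v, some p => planSplit P c k v π p
  | _, _ => ⟨[], [], .retry τ⟩

/-- The next step of thread `t`; `none` if it cannot take a step, because no operation is in
progress or because it is blocked. -/
def threadStep [DecidableEq T] (P : Params) (t : T) (c : Config K V T) : Option (Config K V T) :=
  match c.threads t with
  | .idle _ => none
  | .enter τ => some (c.goto t (enterStep c τ))
  | .retry τ => some (c.goto t (retryStep c τ))
  | .search τ π => (searchStep c τ π).map (c.goto t)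
  | .leafVer τ π =>
      let v := (c.heap π.n).ver
      if scansOnce P τ = false ∧ v % 2 = 1 then some (c.goto t (.leafVer τ π))
      else some (c.goto t (.leafScan τ π v 0))
  | .leafScan τ π v₁ i =>
      if i < P.b then
        if (c.heap π.n).keys i = some π.key then some (c.goto t (.leafVal τ π v₁ i))
        else some (c.goto t (.leafScan τ π v₁ (i + 1)))
      else some (c.goto t (.leafCheck τ π v₁ none))
  | .leafVal τ π v₁ i => some (c.goto t (.leafCheck τ π v₁ ((c.heap π.n).vals i)))
  | .leafCheck τ π v₁ found =>
      if (c.heap π.n).ver = v₁ ∧ v₁ % 2 = 0 then some (c.goto t (afterScan P τ π found))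
      else if scansOnce P τ then some (c.goto t (.elimStart τ π))
      else some (c.goto t (.leafVer τ π))
  | .elimStart τ π => some (c.goto t (.elimVer1 τ π (c.heap π.n).ver))
  | .elimVer1 τ π sv => some (c.goto t (.elimRead τ π sv (c.heap π.n).ver))
  | .elimRead τ π sv v₁ => some (c.goto t (.elimVer2 τ π sv v₁ (c.heap π.n).elimRec))
  | .elimVer2 τ π sv v₁ r =>
      if v₁ % 2 = 1 ∨ (c.heap π.n).ver ≠ v₁ then some (c.goto t (.elimVer1 τ π sv))
      else match r with
        | none => some (c.goto t (.tryLock τ π sv))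
        | some r =>
            if sv ≤ r.ver ∧ r.key = π.key then
              some (c.goto t (match τ with
                | .insert _ _ => .idle r.val
                | _ => .idle none))
            else some (c.goto t (.tryLock τ π sv))
  | .tryLock τ π sv =>
      if (c.heap π.n).queue.isEmpty then
        some ((c.modify π.n fun x => { x with queue := [t] }).goto t (.locked τ π none))
      else some (c.goto t (.elimVer1 τ π sv))
  | .readSibling τ π =>
      match π.p, π.gp with
      | some p, some gp =>
          if (c.heap p).dirty π.sibIdx then none
          else
            let sib := (c.heap p).ptrs[π.sibIdx]?
            some (c.goto t (.run (lockSeq (underfullLocks π sib p gp)) (.locked τ π sib)))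
      | _, _ => some (c.goto t (.retry τ))
  | .run [] next => some (c.goto t next)
  | .run (.await n :: is) next =>
      if (c.heap n).queue.head? = some t then some (c.goto t (.run is next)) else none
  | .run (i :: is) next => some ((i.exec t c).goto t (.run is next))
  | .locked τ π sib =>
      let q := planLocked P c τ π sib
      some ((c.alloc q.new).goto t (.run q.code q.next))
  | .lockedParent τ π =>
      let q := planLockedParent P c τ π
      some ((c.alloc q.new).goto t (.run q.code q.next))

/-- Steps of the system: a thread invokes an operation, a thread takes its next step, and in the
persistent variants a word is written back to persistent memory by the hardware at any time, or
the system crashes and recovers. -/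
inductive Step [DecidableEq T] (P : Params) : Config K V T → Config K V T → Prop where
  | invoke (c : Config K V T) (t : T) (res : Option V) (τ : Task K V)
      (idle : c.threads t = .idle res) (op : τ.IsOperation) : Step P c (c.goto t (.enter τ))
  | act (c c' : Config K V T) (t : T) (step : threadStep P t c = some c') : Step P c c'
  | writeBack (c : Config K V T) (l : Loc) (persistent : P.persist = true) : Step P c (c.flush l)
  | crash (c : Config K V T) (persistent : P.persist = true) : Step P c (c.recover P)

/-- Executions, finite ones being continued by repeating the last configuration. -/
structure IsExecution [DecidableEq T] (P : Params) (k₀ : K) (σ : ℕ → Config K V T) : Prop where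
  init : σ 0 = Config.init k₀
  step : ∀ i, σ (i + 1) = σ i ∨ Step P (σ i) (σ (i + 1))

/-! ### Locks and waiting -/

/-- Thread `t` is executing an operation. -/
def InProgress (c : Config K V T) (t : T) : Prop := ∀ res, c.threads t ≠ .idle res

/-- Thread `t` holds the lock of node `n`. -/
def Holds (c : Config K V T) (t : T) (n : ℕ) : Prop := (c.heap n).queue.head? = some t

/-- Thread `t` acquires the lock of node `n` in a step from `c` to `c'`. -/
def Acquires (c c' : Config K V T) (t : T) (n : ℕ) : Prop := ¬ Holds c t n ∧ Holds c' t n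

/-- Thread `t` waits for other threads at node `n`: it is in the queue of the lock of `n` but not at
its head, or it waits for a marked pointer in `n` to be flushed, or it spins on the odd version of
`n`, or it spins on the lock of `n`. -/
def WaitsAt (P : Params) (c : Config K V T) (t : T) (n : ℕ) : Prop :=
  match c.threads t with
  | .run (.await m :: _) _ => m = n ∧ ¬ Holds c t n
  | .search τ π => π.n = n ∧ ¬ (c.heap n).endsSearch τ n
      ∧ (c.heap n).dirty ((c.heap n).childIdx π.key) = true
  | .readSibling _ π => π.p = some n ∧ (c.heap n).dirty π.sibIdx = true
  | .leafVer τ π => π.n = n ∧ scansOnce P τ = false ∧ (c.heap n).ver % 2 = 1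
  | .elimVer1 _ π _ => π.n = n ∧ (c.heap n).ver % 2 = 1
  | .tryLock _ π _ => π.n = n ∧ (c.heap n).queue ≠ []
  | _ => False

/-- Thread `t` waits for thread `u`: `t` waits at a node whose lock `u` holds, or in whose lock queue
`u` is ahead of `t`. -/
def WaitsFor (P : Params) (c : Config K V T) (t u : T) : Prop :=
  ∃ n, WaitsAt P c t n ∧ (Holds c u n ∨ List.Sublist [u, t] (c.heap n).queue)

/-- A deadlock: a nonempty set of threads each of which waits for a thread of the set, or waits at
a node whose lock no thread holds. -/
def Deadlock (P : Params) (c : Config K V T) (S : Set T) : Prop :=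
  S.Nonempty ∧ ∀ t ∈ S,
    (∃ u ∈ S, WaitsFor P c t u) ∨ ∃ n, WaitsAt P c t n ∧ ∀ u, ¬ Holds c u n

/-! ### The order of the nodes -/

/-- Node `x` is a child of node `y`. -/
def IsChild (c : Config K V T) (x y : ℕ) : Prop := x ∈ (c.heap y).ptrs

/-- Nodes `x` and `y` are children of the same node, `x` to the left of `y`. -/
def IsLeftSibling (c : Config K V T) (x y : ℕ) : Prop :=
  ∃ z i j : ℕ, i < j ∧ (c.heap z).ptrs[i]? = some x ∧ (c.heap z).ptrs[j]? = some y

/-- Bottom to top, siblings from left to right. -/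
def Precedes (c : Config K V T) (x y : ℕ) : Prop := IsChild c x y ∨ IsLeftSibling c x y

end Program

end OCCABtree

open OCCABtree

/-!
The order of the nodes comes from intervals of rational numbers.  When a node is allocated it gets
an interval (`Layout.span`), and each of its child pointers gets the interval of the child that it
points to (`Layout.slots`).  The intervals of the children lie strictly inside that of the parent,
from left to right, with gaps (`Nested`).  A node that replaces another one gets the interval of the
node it replaces, and new inner nodes fit into the gaps since the rationals are dense.  So the
interval of a child pointer never changes, whatever is written to it, and whichever version of it
survives a crash: if `x` is a child of `y` at some time, or a sibling to the left of `y`, then the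
interval of `x` ends before that of `y`.  This does not depend on keys, marks, sizes or heights, nor
on whether the nodes are still linked.  Ordering nodes by the right ends of their intervals, and
then by their references, gives the total order.  `planSplit_ok`, `planFixTagged_ok` and
`planFixUnderfull_ok` find the intervals of the new nodes.

The nodes of a search path, and the sibling that `fixUnderfull` reads, had these positions at some
time, perhaps no longer the current ones.  The intervals record this for ever (`Layout.At`), so the
sequences of locks that the operations acquire follow the order.  The locks held by a thread are
computed from its remaining straight-line code (`heldIn`, `Local.held`).  The invariant `LockInv`
says that this agrees with the lock queues, and that a version is odd or a pointer is marked as not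
flushed only while the lock of the node is held.  `Inv.of_step` shows that both invariants are
preserved, where the layout is extended if nodes are allocated.

In a deadlock every thread would wait for another thread of the set, which is in a lock queue and
hence waits for a lock itself.  Among the nodes whose locks are awaited by such threads choose the
last one, and in its queue the first such thread.  It waits for a thread that is ahead of it in the
queue, or for one that holds the lock and so awaits that of a later node; both are impossible
(`Inv.not_deadlock`).
-/

namespace OCCABtree

/-! ### Nested intervals -/

/-- The intervals in the list lie strictly inside `(A, B)`, from left to right, with gaps before,
between and after them. -/
def Nested : ℚ → ℚ → List (ℚ × ℚ) → Prop
  | A, B, [] => A < B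
  | A, B, J :: L => A < J.1 ∧ J.1 < J.2 ∧ Nested J.2 B L

theorem Nested.mono_left {A A' B : ℚ} (h : A' ≤ A) :
    ∀ {L : List (ℚ × ℚ)}, Nested A B L → Nested A' B L
  | [], hL => lt_of_le_of_lt h hL
  | _ :: _, hL => ⟨lt_of_le_of_lt h hL.1, hL.2⟩

theorem Nested.lt : ∀ {L : List (ℚ × ℚ)} {A B : ℚ}, Nested A B L → A < B
  | [], _, _, h => h
  | _ :: _, _, _, h => h.1.trans (h.2.1.trans h.2.2.lt)

theorem nested_append_cons {L₁ L₂ : List (ℚ × ℚ)} {J : ℚ × ℚ} {A B : ℚ} :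
    Nested A B (L₁ ++ J :: L₂) ↔ Nested A J.1 L₁ ∧ J.1 < J.2 ∧ Nested J.2 B L₂ := by
  induction L₁ generalizing A with
  | nil => rfl
  | cons J' L₁ ih => simp only [List.cons_append, Nested, ih, and_assoc]

theorem Nested.append {L₁ L₂ : List (ℚ × ℚ)} {A B C : ℚ} (h₁ : Nested A C L₁)
    (h₂ : Nested C B L₂) : Nested A B (L₁ ++ L₂) := by
  induction L₁ generalizing A with
  | nil => exact h₂.mono_left h₁.le
  | cons J L₁ ih => exact ⟨h₁.1, h₁.2.1, ih h₁.2.2⟩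

/-- An interval may be replaced by intervals nested in it. -/
theorem Nested.replace {L₁ L L₂ : List (ℚ × ℚ)} {J : ℚ × ℚ} {A B : ℚ}
    (h : Nested A B (L₁ ++ J :: L₂)) (hL : Nested J.1 J.2 L) : Nested A B (L₁ ++ L ++ L₂) := by
  obtain ⟨h₁, -, h₂⟩ := nested_append_cons.1 h
  exact (h₁.append hL).append h₂

theorem Nested.sublist {L L' : List (ℚ × ℚ)} (hs : L'.Sublist L) {A B : ℚ} (h : Nested A B L) :
    Nested A B L' := by
  induction hs generalizing A with
  | slnil => exact h
  | cons J _ ih => exact ih (h.2.2.mono_left (h.1.trans h.2.1).le)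
  | cons_cons J _ ih => exact ⟨h.1, h.2.1, ih h.2.2⟩

theorem Nested.exists_left {L : List (ℚ × ℚ)} {A B : ℚ} (h : Nested A B L) :
    ∃ C, A < C ∧ Nested C B L := by
  cases L with
  | nil => exact exists_between h
  | cons J L =>
    obtain ⟨C, h₁, h₂⟩ := exists_between h.1
    exact ⟨C, h₁, h₂, h.2⟩

theorem Nested.split {L₁ L₂ : List (ℚ × ℚ)} {A B : ℚ} (h : Nested A B (L₁ ++ L₂)) :
    ∃ C, Nested A C L₁ ∧ Nested C B L₂ := by
  induction L₁ generalizing A with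
  | nil => exact h.exists_left
  | cons J L₁ ih =>
    obtain ⟨C, h₁, h₂⟩ := ih h.2.2
    exact ⟨C, ⟨h.1, h.2.1, h₁⟩, h₂⟩

/-- A nested list fits into an interval that is itself nested. -/
theorem Nested.exists_inner {L : List (ℚ × ℚ)} {A B : ℚ} (h : Nested A B L) :
    ∃ J : ℚ × ℚ, Nested A B [J] ∧ Nested J.1 J.2 L := by
  obtain ⟨C, hC, h⟩ := h.exists_left
  obtain ⟨D, h, hD⟩ := Nested.split (L₂ := []) (by simpa using h)
  exact ⟨(C, D), ⟨hC, h.lt, hD⟩, h⟩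

/-- Two consecutive nested lists fit into two consecutive nested intervals. -/
theorem Nested.exists_inner₂ {L₁ L₂ : List (ℚ × ℚ)} {A B : ℚ} (h : Nested A B (L₁ ++ L₂)) :
    ∃ J₁ J₂ : ℚ × ℚ, Nested A B [J₁, J₂] ∧ Nested J₁.1 J₁.2 L₁ ∧ Nested J₂.1 J₂.2 L₂ := by
  obtain ⟨C, h₁, h₂⟩ := h.split
  obtain ⟨J₁, h₁, h₁'⟩ := h₁.exists_inner
  obtain ⟨J₂, h₂, h₂'⟩ := h₂.exists_inner
  exact ⟨J₁, J₂, h₁.append h₂, h₁', h₂'⟩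

theorem Nested.lt_of_getElem? {L : List (ℚ × ℚ)} {A B : ℚ} (h : Nested A B L) {i : ℕ}
    {J : ℚ × ℚ} (hi : L[i]? = some J) : J.2 < B := by
  induction L generalizing A i with
  | nil => simp at hi
  | cons J' L ih =>
    cases i with
    | zero => obtain rfl : J' = J := by simpa using hi
              exact h.2.2.lt
    | succ i => exact ih h.2.2 (by simpa using hi)

theorem Nested.gt_of_getElem? {L : List (ℚ × ℚ)} {A B : ℚ} (h : Nested A B L) {i : ℕ}
    {J : ℚ × ℚ} (hi : L[i]? = some J) : A < J.2 := by
  induction L generalizing A i with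
  | nil => simp at hi
  | cons J' L ih =>
    cases i with
    | zero => obtain rfl : J' = J := by simpa using hi
              exact h.1.trans h.2.1
    | succ i => exact (h.1.trans h.2.1).trans (ih h.2.2 (by simpa using hi))

theorem Nested.lt_of_lt {L : List (ℚ × ℚ)} {A B : ℚ} (h : Nested A B L) {i j : ℕ}
    {J J' : ℚ × ℚ} (hij : i < j) (hi : L[i]? = some J) (hj : L[j]? = some J') : J.2 < J'.2 := by
  induction L generalizing A i j with
  | nil => simp at hi
  | cons J₀ L ih =>
    obtain ⟨j, rfl⟩ := Nat.exists_eq_succ_of_ne_zero (Nat.ne_zero_of_lt hij)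
    cases i with
    | zero => obtain rfl : J₀ = J := by simpa using hi
              exact h.2.2.gt_of_getElem? (i := j) (by simpa using hj)
    | succ i => exact ih h.2.2 (Nat.lt_of_succ_lt_succ hij) (by simpa using hi) (by simpa using hj)

theorem eq_take_append_cons_drop {α : Type*} {L : List α} {i : ℕ} {a : α} (h : L[i]? = some a) :
    L = L.take i ++ a :: L.drop (i + 1) := by
  obtain ⟨hi, rfl⟩ := List.getElem?_eq_some_iff.1 h
  rw [← List.drop_eq_getElem_cons hi, List.take_append_drop]

theorem eq_take_append_cons_cons_drop {α : Type*} {L : List α} {i : ℕ} {a b : α}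
    (h : L[i]? = some a) (h' : L[i + 1]? = some b) :
    L = L.take i ++ a :: b :: L.drop (i + 2) := by
  obtain ⟨hi, rfl⟩ := List.getElem?_eq_some_iff.1 h
  obtain ⟨hi', rfl⟩ := List.getElem?_eq_some_iff.1 h'
  rw [← List.drop_eq_getElem_cons hi', ← List.drop_eq_getElem_cons hi, List.take_append_drop]

/-! ### Layouts -/

/-- An assignment of intervals to the nodes with reference below `size`.  A node keeps its interval
`span n` for ever, and so does each of its child pointers: `slots n` lists the intervals of the
nodes that the child pointers of `n` may point to. -/
structure Layout where
  size : ℕ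
  span : ℕ → ℚ × ℚ
  slots : ℕ → List (ℚ × ℚ)

namespace Layout

/-- `G'` assigns intervals to more nodes than `G`. -/
def Extends (G G' : Layout) : Prop :=
  G.size ≤ G'.size ∧ ∀ n < G.size, G'.span n = G.span n ∧ G'.slots n = G.slots n

theorem Extends.refl (G : Layout) : G.Extends G := ⟨le_rfl, fun _ _ => ⟨rfl, rfl⟩⟩

/-- The order of the nodes, up to nodes that replace each other: intervals are compared by their
right ends. -/
def Before (G : Layout) (x y : ℕ) : Prop := (G.span x).2 < (G.span y).2

theorem Before.ne {G : Layout} {x y : ℕ} (h : G.Before x y) : x ≠ y := by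
  rintro rfl
  exact lt_irrefl _ h

/-- Node `n` has the interval of the `j`-th child pointer of `p`.  This holds for ever if `n` is the
`j`-th child of `p` at some time. -/
structure At (G : Layout) (p j n : ℕ) : Prop where
  parent_lt : p < G.size
  child_lt : n < G.size
  slot : (G.slots p)[j]? = some (G.span n)

theorem At.mono {G G' : Layout} (h : G.Extends G') {p j n : ℕ} (ha : G.At p j n) :
    G'.At p j n where
  parent_lt := ha.parent_lt.trans_le h.1
  child_lt := ha.child_lt.trans_le h.1
  slot := by rw [(h.2 p ha.parent_lt).2, (h.2 n ha.child_lt).1, ha.slot]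

theorem Before.mono {G G' : Layout} (h : G.Extends G') {x y : ℕ} (hx : x < G.size)
    (hy : y < G.size) (hxy : G.Before x y) : G'.Before x y := by
  unfold Before
  rwa [(h.2 x hx).1, (h.2 y hy).1]

/-- The layout describes the child pointers in shared and in persistent memory. -/
structure Fits {K V T : Type*} (G : Layout) (c : Config K V T) : Prop where
  size_eq : G.size = c.next
  pos : 0 < c.next
  nested : ∀ n, Nested (G.span n).1 (G.span n).2 (G.slots n)
  ptrs : ∀ n, (c.heap n).ptrs.map G.span = G.slots n
  pptrs : ∀ n, (c.heap n).pptrs.map G.span = G.slots n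
  ptrs_lt : ∀ n, ∀ m ∈ (c.heap n).ptrs, m < c.next
  pptrs_lt : ∀ n, ∀ m ∈ (c.heap n).pptrs, m < c.next
  slots_eq_nil : ∀ n, c.next ≤ n → G.slots n = []

variable {K V T : Type*} {G : Layout} {c : Config K V T}

theorem Fits.lt_of_mem (hG : G.Fits c) {n m : ℕ} (h : m ∈ (c.heap n).ptrs) : n < c.next := by
  by_contra hn
  have := hG.ptrs n
  rw [hG.slots_eq_nil n (not_lt.1 hn), List.map_eq_nil_iff] at this
  simp [this] at h

theorem Fits.at (hG : G.Fits c) {p j n : ℕ} (h : (c.heap p).ptrs[j]? = some n) : G.At p j n where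
  parent_lt := hG.size_eq ▸ hG.lt_of_mem (List.mem_of_getElem? h)
  child_lt := hG.size_eq ▸ hG.ptrs_lt _ _ (List.mem_of_getElem? h)
  slot := by rw [← hG.ptrs, List.getElem?_map, h]; rfl

theorem Fits.before_parent (hG : G.Fits c) {p j n : ℕ} (h : G.At p j n) : G.Before n p :=
  (hG.nested p).lt_of_getElem? h.slot

theorem Fits.before_sibling (hG : G.Fits c) {p i j n m : ℕ} (hij : i < j) (hn : G.At p i n)
    (hm : G.At p j m) : G.Before n m :=
  (hG.nested p).lt_of_lt hij hn.slot hm.slot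

theorem Fits.before_of_precedes (hG : G.Fits c) {x y : ℕ} (h : Precedes c x y) :
    x < G.size ∧ y < G.size ∧ G.Before x y := by
  rcases h with h | ⟨z, i, j, hij, hx, hy⟩
  · obtain ⟨i, hi⟩ := List.mem_iff_getElem?.1 h
    have := hG.at hi
    exact ⟨this.child_lt, this.parent_lt, hG.before_parent this⟩
  · exact ⟨(hG.at hx).child_lt, (hG.at hy).child_lt, hG.before_sibling hij (hG.at hx) (hG.at hy)⟩

end Layout

/-! ### Locks held by a thread, read off its remaining code -/

section Held

variable {K V T : Type*}

/-- The nodes locked before the given code is executed, if those in `H` are locked afterwards.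
This is computed backwards, as every lock that is released must have been held, and every lock that
is acquired by `await` must not. -/
def heldIn (H : Set ℕ) : List (Instr K V) → Set ℕ
  | [] => H
  | .unlock n :: is => insert n (heldIn H is)
  | .await n :: is => heldIn H is \ {n}
  | _ :: is => heldIn H is

/-- How often the code increments the version of `n`. -/
def bumps (n : ℕ) : List (Instr K V) → ℕ
  | [] => 0
  | .bumpVer m :: is => (if m = n then 1 else 0) + bumps n is
  | _ :: is => bumps n is

/-- The node whose lock the code waits for, if that is its first instruction. -/
def awaited : List (Instr K V) → Option ℕ
  | .await n :: _ => some n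
  | _ => none

/-- The nodes locked in state `locked`. -/
def lockedNodes (τ : Task K V) (π : Path K) (sib : Option ℕ) : List ℕ :=
  match τ, π.p, π.gp with
  | .insert _ _, _, _ => [π.n]
  | .delete _, _, _ => [π.n]
  | .fixTagged _ _, some p, some gp => [π.n, p, gp]
  | .fixUnderfull _ _ _, some p, some gp => underfullLocks π sib p gp
  | _, _, _ => []

/-- The nodes locked in a state other than `run`. -/
def Local.heldAtRest : Local K V → Set ℕ
  | .locked τ π sib => {n | n ∈ lockedNodes τ π sib}
  | .lockedParent _ π => {n | n ∈ π.n :: π.p.toList}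
  | _ => ∅

/-- The straight-line code that a thread is executing. -/
def Local.code : Local K V → List (Instr K V)
  | .run is _ => is
  | _ => []

/-- The nodes locked by a thread in the given local state. -/
def Local.held : Local K V → Set ℕ
  | .run is next => heldIn next.heldAtRest is
  | l => l.heldAtRest

@[simp] theorem Local.held_run (is : List (Instr K V)) (next : Local K V) :
    (Local.run is next).held = heldIn next.heldAtRest is := rfl

@[simp] theorem Local.code_run (is : List (Instr K V)) (next : Local K V) :
    (Local.run is next).code = is := rfl

/-- Correct bookkeeping of accesses to locks, versions and child pointers: locks are acquired in
the order of the layout; versions and child pointers are changed under the lock of the node; when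
it is released, the remaining code neither changes the version again nor leaves a pointer marked
as not flushed; a new child has the interval of its predecessor. -/
def CodeOk (G : Layout) (H : Set ℕ) : List (Instr K V) → Prop
  | [] => True
  | .request n :: is => awaited is = some n ∧ CodeOk G H is
  | .await n :: is =>
      (n < G.size ∧ n ∈ heldIn H is ∧ (∀ m ∈ heldIn H is, m ≠ n → G.Before m n) ∧ bumps n is = 0) ∧
        awaited is = none ∧ CodeOk G H is
  | .unlock n :: is =>
      (n < G.size ∧ n ∉ heldIn H is ∧ bumps n is = 0 ∧ ∀ i, Instr.clearDirty n i ∉ is) ∧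
        awaited is = none ∧ CodeOk G H is
  | .bumpVer n :: is => n ∈ heldIn H is ∧ awaited is = none ∧ CodeOk G H is
  | .setPtr n i m d :: is =>
      (n ∈ heldIn H is ∧ m < G.size ∧ (∀ J, (G.slots n)[i]? = some J → J = G.span m) ∧
        (d = true → Instr.clearDirty n i ∈ is)) ∧ awaited is = none ∧ CodeOk G H is
  | _ :: is => awaited is = none ∧ CodeOk G H is

theorem lt_size_of_mem_heldIn {G : Layout} {H : Set ℕ} (hH : ∀ n ∈ H, n < G.size) :
    ∀ {is : List (Instr K V)}, CodeOk G H is → ∀ n ∈ heldIn H is, n < G.size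
  | [], _, n, hn => hH n hn
  | i :: is, h, n, hn => by
    cases i with
    | unlock m =>
      rcases hn with rfl | hn
      · exact h.1.1
      · exact lt_size_of_mem_heldIn hH h.2.2 n hn
    | await m => exact lt_size_of_mem_heldIn hH h.2.2 n hn.1
    | request m => exact lt_size_of_mem_heldIn hH h.2 n hn
    | bumpVer m => exact lt_size_of_mem_heldIn hH h.2.2 n hn
    | setPtr m i k d => exact lt_size_of_mem_heldIn hH h.2.2 n hn
    | _ => exact lt_size_of_mem_heldIn hH h.2 n hn

theorem CodeOk.mono {G G' : Layout} (hG : G.Extends G') {H : Set ℕ} (hH : ∀ n ∈ H, n < G.size) :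
    ∀ {is : List (Instr K V)}, CodeOk G H is → CodeOk G' H is
  | [], _ => trivial
  | i :: is, h => by
    cases i with
    | unlock m => exact ⟨⟨h.1.1.trans_le hG.1, h.1.2⟩, h.2.1, h.2.2.mono hG hH⟩
    | await m =>
      exact ⟨⟨h.1.1.trans_le hG.1, h.1.2.1, fun k hk hkm =>
        (h.1.2.2.1 k hk hkm).mono hG (lt_size_of_mem_heldIn hH h.2.2 k hk) h.1.1, h.1.2.2.2⟩,
        h.2.1, h.2.2.mono hG hH⟩
    | request m => exact ⟨h.1, h.2.mono hG hH⟩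
    | bumpVer m => exact ⟨h.1, h.2.1, h.2.2.mono hG hH⟩
    | setPtr m i k d =>
      refine ⟨⟨h.1.1, h.1.2.1.trans_le hG.1, fun J hJ => ?_, h.1.2.2.2⟩, h.2.1, h.2.2.mono hG hH⟩
      rw [(hG.2 m (lt_size_of_mem_heldIn hH h.2.2 m h.1.1)).2] at hJ
      rw [(hG.2 k h.1.2.1).1]
      exact h.1.2.2.1 J hJ
    | _ => exact ⟨h.1, h.2.mono hG hH⟩

/-! ### Local states -/

/-- The tasks that lock a leaf. -/
def Task.IsUpdate : Task K V → Prop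
  | .insert _ _ => True
  | .delete _ => True
  | _ => False

/-- Each node of the path has, or once had, the next one as the child with the given index. -/
def PathOk (G : Layout) (π : Path K) : Prop :=
  π.n < G.size ∧ ∀ p, π.p = some p → G.At p π.nIdx π.n ∧ ∀ gp, π.gp = some gp → G.At gp π.pIdx p

theorem PathOk.mono {G G' : Layout} (hG : G.Extends G') {π : Path K} (h : PathOk G π) :
    PathOk G' π :=
  ⟨h.1.trans_le hG.1, fun p hp =>
    ⟨(h.2 p hp).1.mono hG, fun gp hgp => ((h.2 p hp).2 gp hgp).mono hG⟩⟩

/-- The nodes that the task has locked are those it works on. -/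
def LockedOk (G : Layout) (τ : Task K V) (π : Path K) (sib : Option ℕ) : Prop :=
  match τ with
  | .find _ => False
  | .insert _ _ => True
  | .delete _ => True
  | .fixTagged n _ => π.n = n ∧ ∃ p gp, π.p = some p ∧ π.gp = some gp
  | .fixUnderfull n _ _ => π.n = n ∧ ∃ p gp, π.p = some p ∧ π.gp = some gp ∧
      ∀ s, sib = some s → G.At p π.sibIdx s

/-- Invariant of the local states other than `run`. -/
def Local.RestOk (G : Layout) : Local K V → Prop
  | .idle _ => True
  | .enter _ => True
  | .retry _ => True
  | .search _ π => PathOk G π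
  | .leafVer _ π => PathOk G π
  | .leafScan _ π _ _ => PathOk G π
  | .leafVal _ π _ _ => PathOk G π
  | .leafCheck _ π _ _ => PathOk G π
  | .elimStart τ π => τ.IsUpdate ∧ PathOk G π
  | .elimVer1 τ π _ => τ.IsUpdate ∧ PathOk G π
  | .elimRead τ π _ _ => τ.IsUpdate ∧ PathOk G π
  | .elimVer2 τ π _ _ _ => τ.IsUpdate ∧ PathOk G π
  | .tryLock τ π _ => τ.IsUpdate ∧ PathOk G π
  | .readSibling τ π => PathOk G π ∧ ∃ rest ret, τ = .fixUnderfull π.n rest ret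
  | .run _ _ => False
  | .locked τ π sib => PathOk G π ∧ LockedOk G τ π sib
  | .lockedParent τ π => PathOk G π ∧ ∃ k v p, τ = .insert k v ∧ π.p = some p

/-- Invariant of the local state of a thread.  The state after straight-line code is never `run`, so
no recursion is needed. -/
def Local.Ok (G : Layout) : Local K V → Prop
  | .run is next => CodeOk G next.heldAtRest is ∧ next.RestOk G
  | l => l.RestOk G

theorem mem_underfullLocks {π : Path K} {sib : Option ℕ} {p gp n : ℕ} :
    n ∈ underfullLocks π sib p gp ↔ n = π.n ∨ sib = some n ∨ n = p ∨ n = gp := by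
  unfold underfullLocks
  split
  · simp
  · simp
    tauto

theorem Local.RestOk.lt_size {G : Layout} {l : Local K V} (h : l.RestOk G) :
    ∀ n ∈ l.heldAtRest, n < G.size := by
  intro n hn
  cases l with
  | locked τ π sib =>
    obtain ⟨hπ, hl⟩ := h
    cases τ with
    | find k => exact hl.elim
    | insert k v => obtain rfl : n = π.n := by simpa [heldAtRest, lockedNodes] using hn
                    exact hπ.1
    | delete k => obtain rfl : n = π.n := by simpa [heldAtRest, lockedNodes] using hn
                  exact hπ.1
    | fixTagged m ret =>
      obtain ⟨-, p, gp, hp, hgp⟩ := hl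
      have hn : n = π.n ∨ n = p ∨ n = gp := by simpa [heldAtRest, lockedNodes, hp, hgp] using hn
      obtain ⟨h₁, h₂⟩ := hπ.2 p hp
      rcases hn with rfl | rfl | rfl
      exacts [hπ.1, h₁.parent_lt, (h₂ _ hgp).parent_lt]
    | fixUnderfull m rest ret =>
      obtain ⟨-, p, gp, hp, hgp, hs⟩ := hl
      have hn : n ∈ underfullLocks π sib p gp := by
        simpa [heldAtRest, lockedNodes, hp, hgp] using hn
      obtain ⟨h₁, h₂⟩ := hπ.2 p hp
      rcases mem_underfullLocks.1 hn with rfl | h | rfl | rfl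
      exacts [hπ.1, (hs _ h).child_lt, h₁.parent_lt, (h₂ _ hgp).parent_lt]
  | lockedParent τ π =>
    have hn : n = π.n ∨ π.p = some n := by simpa [heldAtRest] using hn
    rcases hn with rfl | hn
    exacts [h.1.1, (h.1.2 n hn).1.parent_lt]
  | _ => exact hn.elim

theorem Local.RestOk.mono {G G' : Layout} (hG : G.Extends G') {l : Local K V} (h : l.RestOk G) :
    l.RestOk G' := by
  cases l with
  | locked τ π sib =>
    refine ⟨h.1.mono hG, ?_⟩
    cases τ with
    | fixUnderfull n rest ret =>
      obtain ⟨hn, p, gp, hp, hgp, hs⟩ := h.2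
      exact ⟨hn, p, gp, hp, hgp, fun s hs' => (hs s hs').mono hG⟩
    | _ => exact h.2
  | lockedParent τ π => exact ⟨h.1.mono hG, h.2⟩
  | readSibling τ π => exact ⟨h.1.mono hG, h.2⟩
  | search τ π => exact PathOk.mono hG h
  | leafVer τ π => exact PathOk.mono hG h
  | leafScan τ π v i => exact PathOk.mono hG h
  | leafVal τ π v i => exact PathOk.mono hG h
  | leafCheck τ π v i => exact PathOk.mono hG h
  | elimStart τ π => exact ⟨h.1, h.2.mono hG⟩
  | elimVer1 τ π _ => exact ⟨h.1, h.2.mono hG⟩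
  | elimRead τ π _ _ => exact ⟨h.1, h.2.mono hG⟩
  | elimVer2 τ π _ _ _ => exact ⟨h.1, h.2.mono hG⟩
  | tryLock τ π _ => exact ⟨h.1, h.2.mono hG⟩
  | run is next => exact h
  | _ => trivial

theorem Local.Ok.cases {G : Layout} {l : Local K V} (h : l.Ok G) :
    (∃ is next, l = .run is next ∧ CodeOk G next.heldAtRest is ∧ next.RestOk G) ∨
      l.RestOk G ∧ l.held = l.heldAtRest ∧ l.code = [] := by
  cases l with
  | run is next => exact Or.inl ⟨is, next, rfl, h⟩
  | _ => exact Or.inr ⟨h, rfl, rfl⟩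

theorem Local.RestOk.held_eq {G : Layout} {l : Local K V} (h : l.RestOk G) :
    l.held = l.heldAtRest ∧ l.code = [] ∧ l.Ok G := by
  cases l with
  | run is next => exact h.elim
  | _ => exact ⟨rfl, rfl, h⟩

theorem Local.Ok.mono {G G' : Layout} (hG : G.Extends G') {l : Local K V} (h : l.Ok G) :
    l.Ok G' := by
  obtain ⟨is, next, rfl, h₁, h₂⟩ | ⟨h, -, -⟩ := h.cases
  · exact ⟨h₁.mono hG h₂.lt_size, h₂.mono hG⟩
  · exact (h.mono hG).held_eq.2.2

theorem Local.Ok.lt_size {G : Layout} {l : Local K V} (h : l.Ok G) : ∀ n ∈ l.held, n < G.size := by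
  obtain ⟨is, next, rfl, h₁, h₂⟩ | ⟨h, e, -⟩ := h.cases
  · exact lt_size_of_mem_heldIn h₂.lt_size h₁
  · exact e ▸ h.lt_size

theorem Local.Ok.awaited_lt_size {G : Layout} {l : Local K V} (h : l.Ok G) {n : ℕ}
    (hn : awaited l.code = some n) : n < G.size := by
  obtain ⟨is, next, rfl, h₁, h₂⟩ | ⟨-, -, e⟩ := h.cases
  · match is with
    | .await m :: is =>
      obtain rfl : m = n := by simpa [code, awaited] using hn
      exact h₁.1.1
  · rw [e] at hn
    cases hn

end Held

/-! ### The locking invariant -/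

section LockInv

variable {K V T : Type*}

/-- The lock queues and the local states of the threads agree, and only a thread that holds the
lock of a node leaves it with an odd version or a marked pointer. -/
structure LockInv (heap : ℕ → Node K V T) (ts : T → Local K V) : Prop where
  mem : ∀ t n, t ∈ (heap n).queue ↔ n ∈ (ts t).held ∨ awaited (ts t).code = some n
  head : ∀ t n, n ∈ (ts t).held → (heap n).queue.head? = some t
  nodup : ∀ n, (heap n).queue.Nodup
  ver : ∀ t n, n ∈ (ts t).held → (heap n).ver % 2 = bumps n (ts t).code % 2
  odd : ∀ n, (heap n).ver % 2 = 1 → ∃ t, n ∈ (ts t).held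
  dirty : ∀ n i, (heap n).dirty i = true →
    ∃ t, n ∈ (ts t).held ∧ Instr.clearDirty n i ∈ (ts t).code

variable {heap heap' : ℕ → Node K V T} {ts : T → Local K V}

theorem LockInv.congr (h : LockInv heap ts) (hq : ∀ n, (heap' n).queue = (heap n).queue)
    (hv : ∀ n, (heap' n).ver = (heap n).ver) (hd : ∀ n, (heap' n).dirty = (heap n).dirty) :
    LockInv heap' ts where
  mem t n := by rw [hq]; exact h.mem t n
  head t n := by rw [hq]; exact h.head t n
  nodup n := by rw [hq]; exact h.nodup n
  ver t n := by rw [hv]; exact h.ver t n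
  odd n := by rw [hv]; exact h.odd n
  dirty n i := by rw [hd]; exact h.dirty n i

/-- Allocation of nodes that no thread has locked or waits for. -/
theorem LockInv.alloc (h : LockInv heap ts)
    (hn : ∀ n, heap' n = heap n ∨ ((∀ t, n ∉ (ts t).held ∧ awaited (ts t).code ≠ some n) ∧
      (heap' n).queue = [] ∧ (heap' n).ver = 0 ∧ (heap' n).dirty = fun _ => false)) :
    LockInv heap' ts where
  mem t n := by
    rcases hn n with e | ⟨h₁, hq, hv, hd⟩
    · rw [e]; exact h.mem t n
    · simp [hq, h₁ t]
  head t n := by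
    rcases hn n with e | ⟨h₁, hq, hv, hd⟩
    · rw [e]; exact h.head t n
    · simp [h₁ t]
  nodup n := by
    rcases hn n with e | ⟨h₁, hq, hv, hd⟩
    · rw [e]; exact h.nodup n
    · simp [hq]
  ver t n := by
    rcases hn n with e | ⟨h₁, hq, hv, hd⟩
    · rw [e]; exact h.ver t n
    · simp [h₁ t]
  odd n := by
    rcases hn n with e | ⟨h₁, hq, hv, hd⟩
    · rw [e]; exact h.odd n
    · simp [hv]
  dirty n i := by
    rcases hn n with e | ⟨h₁, hq, hv, hd⟩
    · rw [e]; exact h.dirty n i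
    · simp [hd]

theorem LockInv.init (hq : ∀ n, (heap n).queue = []) (hv : ∀ n, (heap n).ver = 0)
    (hd : ∀ n, (heap n).dirty = fun _ => false) (hh : ∀ t, (ts t).held = ∅)
    (hc : ∀ t, (ts t).code = []) : LockInv heap ts where
  mem t n := by simp [hq, hh, hc, awaited]
  head t n := by simp [hh]
  nodup n := by simp [hq]
  ver t n := by simp [hh]
  odd n := by simp [hv]
  dirty n i := by simp [hd]

variable [DecidableEq T] {t : T} {l l' : Local K V}

end LockInv

section LockInv

variable {K V T : Type*} {heap heap' : ℕ → Node K V T} {ts : T → Local K V}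
  {t : T}

theorem LockInv.not_held_of_ne (h : LockInv heap ts) {u : T} (hu : u ≠ t) {n : ℕ}
    (hn : n ∈ (ts u).held) : n ∉ (ts t).held := fun hn' =>
  hu (Option.some.inj ((h.head u n hn).symm.trans (h.head t n hn')))

variable [DecidableEq T]

/-- A step of thread `t` preserves the locking invariant if it respects it as far as `t` is
concerned and leaves the other threads in their places in the queues. -/
theorem LockInv.update (h : LockInv heap ts) (l : Local K V)
    (mem : ∀ n, t ∈ (heap' n).queue ↔ n ∈ l.held ∨ awaited l.code = some n)
    (mem_other : ∀ u ≠ t, ∀ n, u ∈ (heap' n).queue ↔ u ∈ (heap n).queue)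
    (head : ∀ n ∈ l.held, (heap' n).queue.head? = some t)
    (head_other : ∀ u ≠ t, ∀ n, (heap n).queue.head? = some u → (heap' n).queue.head? = some u)
    (nodup : ∀ n, (heap' n).queue.Nodup)
    (ver : ∀ n ∈ l.held, (heap' n).ver % 2 = bumps n l.code % 2)
    (ver_eq : ∀ n, n ∉ (ts t).held → (heap' n).ver = (heap n).ver)
    (odd : ∀ n ∈ (ts t).held, (heap' n).ver % 2 = 1 → n ∈ l.held)
    (dirty : ∀ n i, (heap' n).dirty i = true →
      (n ∈ l.held ∧ Instr.clearDirty n i ∈ l.code) ∨ ((heap n).dirty i = true ∧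
        ¬ (n ∈ (ts t).held ∧ Instr.clearDirty n i ∈ (ts t).code))) :
    LockInv heap' (Function.update ts t l) where
  mem u n := by
    rcases eq_or_ne u t with rfl | hu
    · simpa using mem n
    · simpa [hu, mem_other u hu] using h.mem u n
  head u n hn := by
    rcases eq_or_ne u t with rfl | hu
    · exact head n (by simpa using hn)
    · exact head_other u hu n (h.head u n (by simpa [hu] using hn))
  nodup := nodup
  ver u n hn := by
    rcases eq_or_ne u t with rfl | hu
    · simpa using ver n (by simpa using hn)
    · rw [Function.update_of_ne hu] at hn ⊢
      rw [ver_eq n (h.not_held_of_ne hu hn), h.ver u n hn]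
  odd n hn := by
    by_cases ht : n ∈ (ts t).held
    · exact ⟨t, by simpa using odd n ht hn⟩
    · obtain ⟨u, hu⟩ := h.odd n (ver_eq n ht ▸ hn)
      have : u ≠ t := by rintro rfl; exact ht hu
      exact ⟨u, by simpa [this] using hu⟩
  dirty n i hn := by
    rcases dirty n i hn with ht | ⟨hn, ht⟩
    · exact ⟨t, by simpa using ht⟩
    · obtain ⟨u, hu⟩ := h.dirty n i hn
      have : u ≠ t := by rintro rfl; exact ht hu
      exact ⟨u, by simpa [this] using hu⟩

/-- A thread changes its local state, but no lock. -/
theorem LockInv.goto (h : LockInv heap ts) {l : Local K V} (held : l.held = (ts t).held)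
    (hawait : awaited l.code = awaited (ts t).code)
    (ver : ∀ n ∈ (ts t).held, bumps n l.code % 2 = bumps n (ts t).code % 2)
    (dirty : ∀ n i, Instr.clearDirty n i ∈ (ts t).code → Instr.clearDirty n i ∈ l.code) :
    LockInv heap (Function.update ts t l) := by
  refine h.update l ?_ ?_ ?_ ?_ h.nodup ?_ ?_ ?_ ?_
  · intro n; rw [held, hawait]; exact h.mem t n
  · exact fun _ _ _ => Iff.rfl
  · intro n hn; exact h.head t n (held ▸ hn)
  · exact fun _ _ _ h => h
  · intro n hn; rw [ver n (held ▸ hn)]; exact h.ver t n (held ▸ hn)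
  · exact fun _ _ => rfl
  · intro n hn _; rwa [held]
  · intro n i hn
    by_cases ht : n ∈ (ts t).held ∧ Instr.clearDirty n i ∈ (ts t).code
    · exact Or.inl ⟨held ▸ ht.1, dirty n i ht.2⟩
    · exact Or.inr ⟨hn, ht⟩

theorem LockInv.await (h : LockInv heap ts) {n : ℕ} {is : List (Instr K V)} {next : Local K V}
    (hl : ts t = .run (.await n :: is) next) {G : Layout}
    (hc : CodeOk G next.heldAtRest (.await n :: is)) (hn : (heap n).queue.head? = some t) :
    LockInv heap (Function.update ts t (.run is next)) := by
  obtain ⟨⟨-, hmem, -, hb⟩, ha, -⟩ := hc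
  have hheld : (ts t).held = heldIn next.heldAtRest is \ {n} := by rw [hl]; rfl
  have hcode : (ts t).code = .await n :: is := by rw [hl]; rfl
  refine h.update _ ?_ ?_ ?_ ?_ h.nodup ?_ ?_ ?_ ?_
  · intro m
    rw [h.mem t m, hheld, hcode]
    rcases eq_or_ne m n with rfl | hm
    · simp [awaited, hmem]
    · simp [show awaited (.await n :: is) = some n from rfl, hm, hm.symm, ha]
  · exact fun _ _ _ => Iff.rfl
  · intro m hm
    rcases eq_or_ne m n with rfl | hmn
    · exact hn
    · exact h.head t m (by rw [hheld]; exact ⟨hm, hmn⟩)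
  · exact fun _ _ _ h => h
  · intro m hm
    rcases eq_or_ne m n with rfl | hmn
    · simp only [Local.code, hb, Nat.zero_mod]
      by_contra hodd
      obtain ⟨u, hu⟩ := h.odd m (by omega)
      have : u = t := Option.some.inj ((h.head u m hu).symm.trans hn)
      rw [this, hheld] at hu
      exact hu.2 rfl
    · have := h.ver t m (by rw [hheld]; exact ⟨hm, hmn⟩)
      rw [this, hcode]
      rfl
  · exact fun _ _ => rfl
  · intro m hm _
    rw [hheld] at hm
    exact hm.1
  · intro m i hm
    by_cases ht : m ∈ (ts t).held ∧ Instr.clearDirty m i ∈ (ts t).code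
    · rw [hheld, hcode] at ht
      exact Or.inl ⟨ht.1.1, by simpa [Local.code] using ht.2⟩
    · exact Or.inr ⟨hm, ht⟩

theorem LockInv.tryLock (h : LockInv heap ts) (hh : (ts t).held = ∅) (hc : (ts t).code = [])
    {n : ℕ} {x : Node K V T} (hx : (heap n).queue = []) (hq : x.queue = [t])
    (hv : x.ver = (heap n).ver) (hd : x.dirty = (heap n).dirty) {l : Local K V}
    (hl : l.held = {n}) (hlc : l.code = []) :
    LockInv (Function.update heap n x) (Function.update ts t l) := by
  have hnot : ∀ m, t ∉ (heap m).queue := fun m hm => by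
    have := (h.mem t m).1 hm
    simp [hh, hc, awaited] at this
  refine h.update l ?_ ?_ ?_ ?_ ?_ ?_ ?_ ?_ ?_
  · intro m
    rcases eq_or_ne m n with rfl | hm
    · simp [hq, hl]
    · simp [hm, hl, hlc, awaited, hnot]
  · intro u hu m
    rcases eq_or_ne m n with rfl | hm
    · simp [hq, hx, hu]
    · simp [hm]
  · intro m hm
    obtain rfl : m = n := by simpa [hl] using hm
    simp [hq]
  · intro u hu m hm
    rcases eq_or_ne m n with rfl | hmn
    · simp [hx] at hm
    · simpa [hmn] using hm
  · intro m
    rcases eq_or_ne m n with rfl | hm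
    · simp [hq]
    · simpa [hm] using h.nodup m
  · intro m hm
    obtain rfl : m = n := by simpa [hl] using hm
    simp only [Function.update_self, hv, hlc, bumps, Nat.zero_mod]
    by_contra hodd
    obtain ⟨u, hu⟩ := h.odd m (by omega)
    simpa [hx] using h.head u m hu
  · intro m _
    rcases eq_or_ne m n with rfl | hm
    · simp [hv]
    · simp [hm]
  · simp [hh]
  · intro m i hm
    refine Or.inr ⟨?_, by simp [hh]⟩
    rcases eq_or_ne m n with rfl | hmn
    · simpa [hd] using hm
    · simpa [hmn] using hm

/-- An instruction that accesses neither a lock nor a version nor a mark of a pointer. -/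
theorem LockInv.exec_plain (h : LockInv heap ts) {i : Instr K V} {is : List (Instr K V)}
    {next : Local K V} (hl : ts t = .run (i :: is) next) (ha : awaited is = none)
    (hi : awaited (i :: is) = none)
    (hheld : heldIn next.heldAtRest (i :: is) = heldIn next.heldAtRest is)
    (hb : ∀ n, bumps n (i :: is) = bumps n is) (hc : ∀ n j, i ≠ .clearDirty n j)
    (hq : ∀ n, (heap' n).queue = (heap n).queue) (hv : ∀ n, (heap' n).ver = (heap n).ver)
    (hd : ∀ n, (heap' n).dirty = (heap n).dirty) :
    LockInv heap' (Function.update ts t (.run is next)) := by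
  refine LockInv.congr (h.goto ?_ ?_ ?_ ?_) hq hv hd
  · rw [hl, Local.held_run, Local.held_run, hheld]
  · rw [hl, Local.code_run, Local.code_run, ha, hi]
  · intro n _
    rw [hl, Local.code_run, Local.code_run, hb]
  · intro n j
    rw [hl]
    simp [(hc n j).symm]

theorem LockInv.request {c : Config K V T} (h : LockInv c.heap c.threads) {n : ℕ}
    {is : List (Instr K V)} {next : Local K V}
    (hl : c.threads t = .run (.request n :: is) next) {G : Layout}
    (hc : CodeOk G next.heldAtRest (.request n :: is)) :
    LockInv ((Instr.request n : Instr K V).exec t c).heap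
      (Function.update c.threads t (.run is next)) := by
  obtain ⟨hn, hc⟩ := hc
  obtain ⟨is, rfl⟩ : ∃ is', is = .await n :: is' := by
    match is with
    | .await m :: is =>
      obtain rfl : m = n := by simpa [awaited] using hn
      exact ⟨is, rfl⟩
  have hmem := h.mem t
  have hhead := h.head t
  have hver := h.ver t
  rw [hl] at hmem hhead hver
  simp only [Local.held_run, Local.code_run, heldIn, bumps, awaited, reduceCtorEq, or_false]
    at hmem hhead hver
  have hnot : t ∉ (c.heap n).queue := fun hm => ((hmem n).1 hm).2 rfl
  refine h.update _ ?_ ?_ ?_ ?_ ?_ ?_ ?_ ?_ ?_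
  · intro m
    rcases eq_or_ne m n with rfl | hm
    · simp [Instr.exec, Config.modify, awaited]
    · simp [Instr.exec, Config.modify, awaited, hm, hm.symm, hmem, heldIn]
  · intro u hu m
    rcases eq_or_ne m n with rfl | hm
    · simp [Instr.exec, Config.modify, hu]
    · simp [Instr.exec, Config.modify, hm]
  · intro m hm
    have hmn : m ≠ n := hm.2
    simpa [Instr.exec, Config.modify, hmn] using hhead m hm
  · intro u hu m hm
    rcases eq_or_ne m n with rfl | hmn
    · simp [Instr.exec, Config.modify, hm]
    · simpa [Instr.exec, Config.modify, hmn] using hm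
  · intro m
    rcases eq_or_ne m n with rfl | hm
    · simp only [Instr.exec, Config.modify, Function.update_self]
      exact List.nodup_append'.2 ⟨h.nodup m, by simp, by simpa using hnot⟩
    · simpa [Instr.exec, Config.modify, hm] using h.nodup m
  · intro m hm
    have hmn : m ≠ n := hm.2
    simpa [Instr.exec, Config.modify, hmn, bumps] using hver m hm
  · intro m _
    rcases eq_or_ne m n with rfl | hm
    · simp [Instr.exec, Config.modify]
    · simp [Instr.exec, Config.modify, hm]
  · intro m hm _
    rw [hl] at hm
    exact hm
  · intro m i hm
    have hm : (c.heap m).dirty i = true := by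
      rcases eq_or_ne m n with rfl | hmn
      · simpa [Instr.exec, Config.modify] using hm
      · simpa [Instr.exec, Config.modify, hmn] using hm
    rw [hl]
    by_cases ht : m ∈ heldIn next.heldAtRest (.await n :: is) ∧ Instr.clearDirty m i ∈ is
    · exact Or.inl (by simpa using ht)
    · exact Or.inr ⟨hm, by simpa [heldIn] using ht⟩

theorem LockInv.unlock {c : Config K V T} (h : LockInv c.heap c.threads) {n : ℕ}
    {is : List (Instr K V)} {next : Local K V}
    (hl : c.threads t = .run (.unlock n :: is) next) {G : Layout}
    (hc : CodeOk G next.heldAtRest (.unlock n :: is)) :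
    LockInv ((Instr.unlock n : Instr K V).exec t c).heap
      (Function.update c.threads t (.run is next)) := by
  obtain ⟨⟨-, hn, hb, hd⟩, ha, hc⟩ := hc
  have hmem := h.mem t
  have hhead := h.head t
  have hver := h.ver t
  rw [hl] at hmem hhead hver
  simp only [Local.held_run, Local.code_run, heldIn, bumps, awaited, reduceCtorEq, or_false,
    Set.mem_insert_iff] at hmem hhead hver
  obtain ⟨q, hq⟩ : ∃ q, (c.heap n).queue = t :: q := by
    have := hhead n (Or.inl rfl)
    rw [List.head?_eq_some_iff] at this
    exact this
  have hnd := h.nodup n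
  rw [hq, List.nodup_cons] at hnd
  refine h.update _ ?_ ?_ ?_ ?_ ?_ ?_ ?_ ?_ ?_
  · intro m
    rcases eq_or_ne m n with rfl | hm
    · simp [Instr.exec, Config.modify, hq, hnd.1, hn, ha]
    · simp [Instr.exec, Config.modify, hm, hmem, ha]
  · intro u hu m
    rcases eq_or_ne m n with rfl | hm
    · simp [Instr.exec, Config.modify, hq, hu]
    · simp [Instr.exec, Config.modify, hm]
  · intro m hm
    rcases eq_or_ne m n with rfl | hmn
    · exact (hn hm).elim
    · simpa [Instr.exec, Config.modify, hmn] using hhead m (Or.inr hm)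
  · intro u hu m hm
    rcases eq_or_ne m n with rfl | hmn
    · simp [hq, hu.symm] at hm
    · simpa [Instr.exec, Config.modify, hmn] using hm
  · intro m
    rcases eq_or_ne m n with rfl | hm
    · simp [Instr.exec, Config.modify, hq, hnd.2]
    · simpa [Instr.exec, Config.modify, hm] using h.nodup m
  · intro m hm
    rcases eq_or_ne m n with rfl | hmn
    · exact (hn hm).elim
    · simpa [Instr.exec, Config.modify, hmn] using hver m (Or.inr hm)
  · intro m _
    rcases eq_or_ne m n with rfl | hm
    · simp [Instr.exec, Config.modify]
    · simp [Instr.exec, Config.modify, hm]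
  · intro m hm hodd
    rw [hl] at hm
    rcases hm with rfl | hm
    · have := hver m (Or.inl rfl)
      simp only [Instr.exec, Config.modify, Function.update_self] at hodd
      rw [hb] at this
      omega
    · exact hm
  · intro m i hm
    have hm : (c.heap m).dirty i = true := by
      rcases eq_or_ne m n with rfl | hmn
      · simpa [Instr.exec, Config.modify] using hm
      · simpa [Instr.exec, Config.modify, hmn] using hm
    rw [hl]
    by_cases ht : m ∈ heldIn next.heldAtRest is ∧ Instr.clearDirty m i ∈ is
    · exact Or.inl (by simpa using ht)
    · refine Or.inr ⟨hm, fun ⟨h₁, h₂⟩ => ?_⟩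
      have h₃ : Instr.clearDirty m i ∈ is := by simpa using h₂
      rcases h₁ with rfl | h₁
      · exact hd i h₃
      · exact ht ⟨h₁, h₃⟩

theorem LockInv.bumpVer {c : Config K V T} (h : LockInv c.heap c.threads) {n : ℕ}
    {is : List (Instr K V)} {next : Local K V}
    (hl : c.threads t = .run (.bumpVer n :: is) next) {G : Layout}
    (hc : CodeOk G next.heldAtRest (.bumpVer n :: is)) :
    LockInv ((Instr.bumpVer n : Instr K V).exec t c).heap
      (Function.update c.threads t (.run is next)) := by
  obtain ⟨hn, ha, hc⟩ := hc
  have hmem := h.mem t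
  have hhead := h.head t
  have hver := h.ver t
  rw [hl] at hmem hhead hver
  simp only [Local.held_run, Local.code_run, heldIn, bumps, awaited, reduceCtorEq, or_false]
    at hmem hhead hver
  have hq : ∀ m, (((Instr.bumpVer n : Instr K V).exec t c).heap m).queue = (c.heap m).queue := by
    intro m
    rcases eq_or_ne m n with rfl | hm
    · simp [Instr.exec, Config.modify]
    · simp [Instr.exec, Config.modify, hm]
  refine h.update _ ?_ ?_ ?_ ?_ ?_ ?_ ?_ ?_ ?_
  · intro m
    simp [hq, hmem, ha]
  · intro u hu m
    rw [hq]
  · intro m hm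
    rw [hq]
    exact hhead m hm
  · intro u hu m hm
    rwa [hq]
  · intro m
    rw [hq]
    exact h.nodup m
  · intro m hm
    have := hver m hm
    rcases eq_or_ne m n with rfl | hmn
    · simp only [if_true] at this
      simp only [Instr.exec, Config.modify, Function.update_self, Local.code_run]
      omega
    · simpa [Instr.exec, Config.modify, hmn, hmn.symm] using this
  · intro m hm
    rcases eq_or_ne m n with rfl | hmn
    · rw [hl] at hm
      exact (hm hn).elim
    · simp [Instr.exec, Config.modify, hmn]
  · intro m hm _
    rw [hl] at hm
    exact hm
  · intro m i hm
    have hm : (c.heap m).dirty i = true := by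
      rcases eq_or_ne m n with rfl | hmn
      · simpa [Instr.exec, Config.modify] using hm
      · simpa [Instr.exec, Config.modify, hmn] using hm
    rw [hl]
    by_cases ht : m ∈ heldIn next.heldAtRest is ∧ Instr.clearDirty m i ∈ is
    · exact Or.inl (by simpa using ht)
    · exact Or.inr ⟨hm, by simpa [heldIn] using ht⟩

/-- Instructions that change the mark of the child pointer `i` of `n`. -/
theorem LockInv.exec_dirty (h : LockInv heap ts) {j : Instr K V} {is : List (Instr K V)}
    {next : Local K V} (hl : ts t = .run (j :: is) next) (ha : awaited is = none)
    (hj : awaited (j :: is) = none)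
    (hheld : heldIn next.heldAtRest (j :: is) = heldIn next.heldAtRest is)
    (hb : ∀ n, bumps n (j :: is) = bumps n is)
    (hq : ∀ n, (heap' n).queue = (heap n).queue) (hv : ∀ n, (heap' n).ver = (heap n).ver)
    (hd : ∀ n i, (heap' n).dirty i = true →
      (n ∈ heldIn next.heldAtRest is ∧ Instr.clearDirty n i ∈ is) ∨
        ((heap n).dirty i = true ∧ Instr.clearDirty n i ≠ j)) :
    LockInv heap' (Function.update ts t (.run is next)) := by
  refine h.update _ ?_ ?_ ?_ ?_ ?_ ?_ ?_ ?_ ?_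
  · intro m
    rw [hq, h.mem t m, hl]
    simp [hheld, ha, hj]
  · intro u hu m
    rw [hq]
  · intro m hm
    rw [hq]
    exact h.head t m (by rw [hl, Local.held_run, hheld]; exact hm)
  · intro u hu m hm
    rwa [hq]
  · intro m
    rw [hq]
    exact h.nodup m
  · intro m hm
    rw [hv, h.ver t m (by rw [hl, Local.held_run, hheld]; exact hm), hl]
    simp [hb]
  · exact fun m _ => hv m
  · intro m hm _
    rw [hl, Local.held_run, hheld] at hm
    exact hm
  · intro m i hm
    simp only [hl, Local.held_run, hheld, Local.code_run]
    rcases hd m i hm with hm | ⟨hm, hne⟩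
    · exact Or.inl hm
    · by_cases ht : m ∈ heldIn next.heldAtRest is ∧ Instr.clearDirty m i ∈ is
      · exact Or.inl ht
      · exact Or.inr ⟨hm, by simpa [hne] using ht⟩

/-- Execution of an instruction other than `await`. -/
theorem LockInv.exec {c : Config K V T} (h : LockInv c.heap c.threads) {i : Instr K V}
    {is : List (Instr K V)} {next : Local K V} (hl : c.threads t = .run (i :: is) next)
    (hi : ∀ n, i ≠ .await n) {G : Layout} (hc : CodeOk G next.heldAtRest (i :: is)) :
    LockInv (i.exec t c).heap (Function.update c.threads t (.run is next)) := by
  cases i with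
  | await n => exact absurd rfl (hi n)
  | request n => exact h.request hl hc
  | unlock n => exact h.unlock hl hc
  | bumpVer n => exact h.bumpVer hl hc
  | setPtr n i m d =>
    obtain ⟨⟨hn, -, -, hd⟩, ha, -⟩ := hc
    refine h.exec_dirty hl ha rfl rfl (fun _ => rfl) ?_ ?_ ?_
    · intro k
      rcases eq_or_ne k n with rfl | hk <;> simp [Instr.exec, Config.modify, *]
    · intro k
      rcases eq_or_ne k n with rfl | hk <;> simp [Instr.exec, Config.modify, *]
    · intro k j hk
      rcases eq_or_ne k n with rfl | hkn
      · rcases eq_or_ne j i with rfl | hj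
        · exact Or.inl ⟨hn, hd (by simpa [Instr.exec, Config.modify] using hk)⟩
        · exact Or.inr ⟨by simpa [Instr.exec, Config.modify, hj] using hk, by simp⟩
      · exact Or.inr ⟨by simpa [Instr.exec, Config.modify, hkn] using hk, by simp⟩
  | clearDirty n i =>
    refine h.exec_dirty hl hc.1 rfl rfl (fun _ => rfl) ?_ ?_ ?_
    · intro k
      rcases eq_or_ne k n with rfl | hk <;> simp [Instr.exec, Config.modify, *]
    · intro k
      rcases eq_or_ne k n with rfl | hk <;> simp [Instr.exec, Config.modify, *]
    · intro k j hk
      rcases eq_or_ne k n with rfl | hkn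
      · rcases eq_or_ne j i with rfl | hj
        · simp [Instr.exec, Config.modify] at hk
        · exact Or.inr ⟨by simpa [Instr.exec, Config.modify, hj] using hk, by simp [hj]⟩
      · exact Or.inr ⟨by simpa [Instr.exec, Config.modify, hkn] using hk, by simp [hkn]⟩
  | flush l =>
    refine h.exec_plain hl hc.1 rfl rfl (fun _ => rfl) (by simp) ?_ ?_ ?_ <;> intro k
    all_goals
      cases l with
      | _ n => rcases eq_or_ne k n with rfl | hk <;>
                simp [Instr.exec, Config.flush, Config.modify, *]
  | _ n =>
    refine h.exec_plain hl hc.1 rfl rfl (fun _ => rfl) (by simp) ?_ ?_ ?_ <;> intro k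
    all_goals rcases eq_or_ne k n with rfl | hk <;> simp [Instr.exec, Config.modify, *]

end LockInv

/-! ### Straight-line code -/

section Code

variable {K V T : Type*} {G : Layout}

/-- A thread that holds the locks of the nodes in `H` may execute the given code and continue in
state `next`. -/
structure RunOk (G : Layout) (H : Set ℕ) (code : List (Instr K V)) (next : Local K V) : Prop where
  code_ok : CodeOk G next.heldAtRest code
  rest_ok : next.RestOk G
  held : heldIn next.heldAtRest code = H
  awaited_eq : awaited code = none
  bumps_even : ∀ n, bumps n code % 2 = 0

theorem RunOk.mono {G' : Layout} (hG : G.Extends G') {H : Set ℕ} {code : List (Instr K V)}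
    {next : Local K V} (h : RunOk G H code next) : RunOk G' H code next :=
  ⟨h.code_ok.mono hG h.rest_ok.lt_size, h.rest_ok.mono hG, h.held, h.awaited_eq, h.bumps_even⟩

/-- Instructions that need no lock. -/
def Instr.IsPlain : Instr K V → Prop
  | .setRec _ _ => True
  | .setKey _ _ _ => True
  | .setVal _ _ _ => True
  | .setSize _ _ => True
  | .setMarked _ => True
  | .flush _ => True
  | .clearDirty _ _ => True
  | _ => False

theorem RunOk.plain {H : Set ℕ} {code : List (Instr K V)} {next : Local K V}
    (h : RunOk G H code next) {i : Instr K V} (hi : i.IsPlain) : RunOk G H (i :: code) next := by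
  cases i with
  | request _ => exact hi.elim
  | await _ => exact hi.elim
  | unlock _ => exact hi.elim
  | bumpVer _ => exact hi.elim
  | setPtr _ _ _ _ => exact hi.elim
  | _ => exact ⟨⟨h.awaited_eq, h.code_ok⟩, h.rest_ok, h.held, rfl, h.bumps_even⟩

theorem RunOk.plains {H : Set ℕ} {code : List (Instr K V)} {next : Local K V}
    (h : RunOk G H code next) {is : List (Instr K V)} (hi : ∀ i ∈ is, i.IsPlain) :
    RunOk G H (is ++ code) next := by
  induction is with
  | nil => exact h
  | cons i is ih =>
    exact (ih fun j hj => hi j (List.mem_cons_of_mem _ hj)).plain (hi i List.mem_cons_self)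

/-- The new child pointer gets the interval of the node `n` that it replaces. -/
theorem RunOk.link {H : Set ℕ} {code : List (Instr K V)} {next : Local K V}
    (h : RunOk G H code next) (P : Params) {p i n m : ℕ} (hp : p ∈ H) (hm : m < G.size)
    (hat : G.At p i n) (hs : G.span m = G.span n) :
    RunOk G H (linkScript P p i m ++ code) next := by
  have hJ : ∀ J, (G.slots p)[i]? = some J → J = G.span m := fun J hJ => by
    rw [hs]
    exact Option.some.inj (hJ.symm.trans hat.slot)
  have hp' : p ∈ heldIn next.heldAtRest code := h.held ▸ hp
  have h' := (h.plain (i := .clearDirty p i) trivial).plain (i := .flush (.ptr p i)) trivial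
  unfold linkScript
  split
  · exact ⟨⟨⟨hp', hm, hJ, by simp⟩, rfl, h'.code_ok⟩, h.rest_ok, h.held, rfl, h.bumps_even⟩
  · exact ⟨⟨⟨hp', hm, hJ, by simp⟩, h.awaited_eq, h.code_ok⟩, h.rest_ok, h.held, rfl, h.bumps_even⟩

/-- States in which a thread holds no locks and that satisfy the invariant trivially. -/
def Local.IsStart : Local K V → Prop
  | .idle _ => True
  | .enter _ => True
  | .retry _ => True
  | _ => False

theorem Local.IsStart.rest {l : Local K V} (h : l.IsStart) :
    l.RestOk G ∧ l.heldAtRest = ∅ := by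
  cases l with
  | idle _ => exact ⟨trivial, rfl⟩
  | enter _ => exact ⟨trivial, rfl⟩
  | retry _ => exact ⟨trivial, rfl⟩
  | _ => exact h.elim

theorem finish_isStart (rest : List ℕ) (ret : Option V) :
    (finish rest ret : Local K V).IsStart := by
  cases rest <;> trivial

theorem return_isStart (τ : Task K V) : τ.return.IsStart := by
  cases τ with
  | fixUnderfull n rest ret => exact finish_isStart rest ret
  | _ => trivial

theorem heldIn_unlockSeq (ns : List ℕ) :
    heldIn ∅ (unlockSeq ns : List (Instr K V)) = {n | n ∈ ns} := by
  induction ns with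
  | nil => ext; simp [unlockSeq, heldIn]
  | cons n ns ih =>
    ext m
    simp only [unlockSeq, List.map_cons, heldIn, Set.mem_insert_iff, Set.mem_ofPred_eq,
      List.mem_cons] at ih ⊢
    rw [ih, Set.mem_ofPred_eq]

theorem bumps_unlockSeq (n : ℕ) (ns : List ℕ) : bumps n (unlockSeq ns : List (Instr K V)) = 0 := by
  induction ns with
  | nil => rfl
  | cons m ns ih => exact ih

theorem awaited_unlockSeq (ns : List ℕ) : awaited (unlockSeq ns : List (Instr K V)) = none := by
  cases ns <;> rfl

theorem runOk_unlockSeq {ns : List ℕ} (hns : ns.Nodup) (hlt : ∀ n ∈ ns, n < G.size)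
    {next : Local K V} (hnext : next.IsStart) : RunOk G {n | n ∈ ns} (unlockSeq ns) next := by
  obtain ⟨hr, hh⟩ := hnext.rest (G := G)
  refine ⟨?_, hr, by rw [hh, heldIn_unlockSeq], awaited_unlockSeq ns,
    fun n => by rw [bumps_unlockSeq]⟩
  rw [hh]
  induction ns with
  | nil => trivial
  | cons n ns ih =>
    rw [List.nodup_cons] at hns
    refine ⟨⟨hlt n List.mem_cons_self, ?_, bumps_unlockSeq n ns, ?_⟩, awaited_unlockSeq ns,
      ih hns.2 fun m hm => hlt m (List.mem_cons_of_mem _ hm)⟩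
    · rw [← unlockSeq, heldIn_unlockSeq]
      exact hns.1
    · simp

theorem bumps_lockSeq (n : ℕ) (ns : List ℕ) : bumps n (lockSeq ns : List (Instr K V)) = 0 := by
  induction ns with
  | nil => rfl
  | cons m ns ih => exact ih

theorem awaited_lockSeq (ns : List ℕ) : awaited (lockSeq ns : List (Instr K V)) = none := by
  cases ns <;> rfl

theorem heldIn_lockSeq (H : Set ℕ) (ns : List ℕ) :
    heldIn H (lockSeq ns : List (Instr K V)) = H \ {n | n ∈ ns} := by
  induction ns with
  | nil => ext; simp [lockSeq, heldIn]
  | cons n ns ih =>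
    have : heldIn H (lockSeq (n :: ns) : List (Instr K V)) =
      heldIn H (lockSeq ns : List (Instr K V)) \ {n} := rfl
    rw [this, ih]
    ext m
    simp only [Set.mem_sdiff, Set.mem_ofPred_eq, Set.mem_singleton_iff, List.mem_cons]
    tauto

/-- Locks are acquired in the order of the layout, beyond those that are held already. -/
theorem codeOk_lockSeq {H : Set ℕ} {ns : List ℕ} (hns : ns.Pairwise G.Before)
    (hH : ∀ n ∈ ns, n ∈ H) (hlt : ∀ n ∈ ns, n < G.size)
    (hbefore : ∀ m ∈ H, m ∉ ns → ∀ n ∈ ns, G.Before m n) :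
    CodeOk G H (lockSeq ns : List (Instr K V)) := by
  induction ns with
  | nil => trivial
  | cons n ns ih =>
    rw [List.pairwise_cons] at hns
    refine ⟨rfl, ⟨hlt n List.mem_cons_self, ?_, ?_, bumps_lockSeq n ns⟩, awaited_lockSeq ns, ?_⟩
    · change n ∈ heldIn H (lockSeq ns)
      rw [heldIn_lockSeq]
      exact ⟨hH n List.mem_cons_self, fun h => (hns.1 n h).ne rfl⟩
    · change ∀ m ∈ heldIn H (lockSeq ns), _
      rw [heldIn_lockSeq]
      intro m hm hmn
      exact hbefore m hm.1 (by simpa [hmn] using hm.2) n List.mem_cons_self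
    · refine ih hns.2 (fun m hm => hH m (List.mem_cons_of_mem _ hm))
        (fun m hm => hlt m (List.mem_cons_of_mem _ hm)) fun m hm hmns k hk => ?_
      rcases eq_or_ne m n with rfl | hmn
      · exact hns.1 k hk
      · exact hbefore m hm (by simp [hmn, hmns]) k (List.mem_cons_of_mem _ hk)

theorem runOk_lockSeq {H : Set ℕ} {next : Local K V} (hnext : next.RestOk G) {ns : List ℕ}
    (hns : ns.Pairwise G.Before) (hH : next.heldAtRest = H ∪ {n | n ∈ ns})
    (hdisj : ∀ n ∈ H, n ∉ ns) (hbefore : ∀ m ∈ H, ∀ n ∈ ns, G.Before m n) :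
    RunOk G H (lockSeq ns) next where
  code_ok := by
    refine codeOk_lockSeq hns (fun n hn => hH ▸ Or.inr hn)
      (fun n hn => hnext.lt_size n (hH ▸ Or.inr hn)) fun m hm hmns n hn => ?_
    rw [hH] at hm
    exact hbefore m (hm.resolve_right hmns) n hn
  rest_ok := hnext
  held := by
    rw [heldIn_lockSeq, hH]
    ext n
    have := hdisj n
    simp only [Set.mem_sdiff, Set.mem_union, Set.mem_ofPred_eq]
    tauto
  awaited_eq := awaited_lockSeq ns
  bumps_even n := by rw [bumps_lockSeq]

/-- Code that changes the version twice, around accesses to the slots. -/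
theorem runOk_bump {n : ℕ} (hn : n < G.size) {is : List (Instr K V)} (his : ∀ i ∈ is, i.IsPlain)
    {next : Local K V} (hnext : next.IsStart) :
    RunOk G {n} (.bumpVer n :: (is ++ [.bumpVer n, .unlock n])) next := by
  obtain ⟨hr, hh⟩ := hnext.rest (G := G)
  have hb : ∀ m, bumps m (is ++ [.bumpVer n, .unlock n]) = if n = m then 1 else 0 := by
    intro m
    induction is with
    | nil => rfl
    | cons i is ih =>
      have := ih fun j hj => his j (List.mem_cons_of_mem _ hj)
      have hi := his i List.mem_cons_self
      cases i with
      | bumpVer _ => exact hi.elim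
      | _ => exact this
  have key : CodeOk G next.heldAtRest (is ++ [.bumpVer n, .unlock n]) ∧
      heldIn next.heldAtRest (is ++ [.bumpVer n, .unlock n]) = {n} ∧
      awaited (is ++ [.bumpVer n, .unlock n]) = none := by
    clear hb
    induction is with
    | nil => exact ⟨by simp [CodeOk, heldIn, hh, hn, bumps, awaited], by simp [heldIn, hh], rfl⟩
    | cons i is ih =>
      obtain ⟨h₁, h₂, h₃⟩ := ih fun j hj => his j (List.mem_cons_of_mem _ hj)
      have hi := his i List.mem_cons_self
      cases i with
      | request _ => exact hi.elim
      | await _ => exact hi.elim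
      | unlock _ => exact hi.elim
      | bumpVer _ => exact hi.elim
      | setPtr _ _ _ _ => exact hi.elim
      | _ => exact ⟨⟨h₃, h₁⟩, h₂, rfl⟩
  refine ⟨⟨?_, key.2.2, key.1⟩, hr, key.2.1, rfl, fun m => ?_⟩
  · rw [key.2.1]
    rfl
  · simp only [bumps, hb]
    split <;> rfl

theorem runOk_insertScript {P : Params} {n : ℕ} (hn : n < G.size) (x : Node K V T) (i : ℕ) (k : K)
    (v : V) {next : Local K V} (hnext : next.IsStart) :
    RunOk G {n} (insertScript P n x i k v) next := by
  have : insertScript P n x i k v = .bumpVer n ::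
      (((if P.elim then [.setRec n ⟨k, some v, x.ver + 1⟩] else []) ++
      (if P.persist then
        [.setVal n i (some v), .flush (.val n i), .setKey n i (some k), .flush (.key n i)]
      else [.setKey n i (some k), .setVal n i (some v)]) ++ [.setSize n (x.size + 1)]) ++
      [.bumpVer n, .unlock n]) := by simp [insertScript]
  rw [this]
  refine runOk_bump hn ?_ hnext
  cases P.elim <;> cases P.persist <;> simp [Instr.IsPlain]

theorem runOk_deleteScript {P : Params} {n : ℕ} (hn : n < G.size) (x : Node K V T) (i : ℕ) (k : K)
    {next : Local K V} (hnext : next.IsStart) :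
    RunOk G {n} (deleteScript P n x i k) next := by
  have : deleteScript P n x i k = .bumpVer n ::
      (((if P.elim then [.setRec n ⟨k, x.vals i, x.ver + 1⟩] else []) ++ [.setKey n i none] ++
      (if P.persist then [.flush (.key n i)] else []) ++ [.setSize n (x.size - 1)]) ++
      [.bumpVer n, .unlock n]) := by simp [deleteScript]
  rw [this]
  refine runOk_bump hn ?_ hnext
  cases P.elim <;> cases P.persist <;> simp [Instr.IsPlain]

end Code

/-! ### Allocation -/

section Alloc

variable {K V T : Type*}

/-- The interval `J` is given to the new node `x`, whose child pointers have the intervals that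
the layout `G` gives to the children. -/
structure NewOk (G : Layout) (x : Node K V T) (J : ℚ × ℚ) : Prop where
  nested : Nested J.1 J.2 (x.ptrs.map G.span)
  ptrs_lt : ∀ m ∈ x.ptrs, m < G.size
  pptrs : x.pptrs = x.ptrs
  queue : x.queue = []
  ver : x.ver = 0
  dirty : x.dirty = fun _ => false

theorem newOk_mkLeaf {G : Layout} {J : ℚ × ℚ} (d : K) (l : List (K × Option V)) (hJ : J.1 < J.2) :
    NewOk G (mkLeaf d l : Node K V T) J :=
  ⟨hJ, by simp [mkLeaf], rfl, rfl, rfl, rfl⟩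

theorem newOk_mkInternal {G : Layout} {J : ℚ × ℚ} (kind : Kind) (d : K) (ks : List K) {ps : List ℕ}
    (hJ : Nested J.1 J.2 (ps.map G.span)) (hps : ∀ m ∈ ps, m < G.size) :
    NewOk G (mkInternal kind d ks ps : Node K V T) J :=
  ⟨hJ, hps, rfl, rfl, rfl, rfl⟩

namespace Layout

/-- The intervals after allocation of new nodes with the intervals in `Js`. -/
def allocSpan (G : Layout) (Js : List (ℚ × ℚ)) (n : ℕ) : ℚ × ℚ :=
  if n < G.size then G.span n else Js[n - G.size]?.getD (G.span n)

/-- The layout after allocation of the new nodes `new` with the intervals in `Js`. -/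
def alloc (G : Layout) (new : List (Node K V T)) (Js : List (ℚ × ℚ)) : Layout where
  size := G.size + new.length
  span := G.allocSpan Js
  slots := fun n => if n < G.size then G.slots n else
    (new[n - G.size]?.map fun x => x.ptrs.map (G.allocSpan Js)).getD []

variable {G : Layout} {c : Config K V T} {new : List (Node K V T)} {Js : List (ℚ × ℚ)}

theorem extends_alloc (G : Layout) (new : List (Node K V T)) (Js : List (ℚ × ℚ)) :
    G.Extends (G.alloc new Js) :=
  ⟨Nat.le_add_right _ _, fun n hn => ⟨by simp [alloc, allocSpan, hn], by simp [alloc, hn]⟩⟩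

theorem Fits.map_alloc (hG : G.Fits c) (new : List (Node K V T)) (Js : List (ℚ × ℚ)) {l : List ℕ}
    (hl : ∀ m ∈ l, m < c.next) : l.map (G.alloc new Js).span = l.map G.span :=
  List.map_congr_left fun m hm => ((extends_alloc G new Js).2 m (hG.size_eq ▸ hl m hm)).1

theorem Fits.alloc (hG : G.Fits c) (h : List.Forall₂ (NewOk (G.alloc new Js)) new Js) :
    (G.alloc new Js).Fits (c.alloc new) := by
  have hlen := h.length_eq
  have hnew : ∀ n x, new[n - G.size]? = some x → ∃ J, Js[n - G.size]? = some J ∧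
      NewOk (G.alloc new Js) x J := by
    intro n x hx
    obtain ⟨hi, rfl⟩ := List.getElem?_eq_some_iff.1 hx
    exact ⟨Js[n - G.size], by simp [← hlen, hi], h.get _ _⟩
  have hheap : ∀ n, (n < G.size ∧ (c.alloc new).heap n = c.heap n ∧
        (G.alloc new Js).slots n = G.slots n ∧ (G.alloc new Js).span n = G.span n) ∨
      (∃ x J, (c.alloc new).heap n = x ∧ NewOk (G.alloc new Js) x J ∧
        (G.alloc new Js).slots n = x.ptrs.map (G.alloc new Js).span ∧
        (G.alloc new Js).span n = J) ∨
      ((c.alloc new).heap n = c.heap n ∧ G.slots n = [] ∧ (G.alloc new Js).slots n = [] ∧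
        (G.alloc new Js).span n = G.span n) := by
    intro n
    rcases lt_or_ge n G.size with hn | hn
    · left
      have e := (extends_alloc G new Js).2 n hn
      exact ⟨hn, by simp [Config.alloc, ← hG.size_eq, hn], e.2, e.1⟩
    · right
      rcases hx : new[n - G.size]? with _ | x
      · right
        have hJ : Js[n - G.size]? = none := by
          rw [List.getElem?_eq_none_iff] at hx ⊢
          omega
        refine ⟨by simp [Config.alloc, ← hG.size_eq, hx], hG.slots_eq_nil n (hG.size_eq ▸ hn),
          ?_, ?_⟩
        · simp [Layout.alloc, hx, hn.not_gt]
        · simp [Layout.alloc, allocSpan, hJ]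
      · left
        obtain ⟨J, hJ, hok⟩ := hnew n x hx
        refine ⟨x, J, ?_, hok, ?_, ?_⟩
        · simp [Config.alloc, ← hG.size_eq, hx, hn.not_gt]
        · simp [Layout.alloc, hx, hn.not_gt]
        · simp [Layout.alloc, allocSpan, hJ, hn.not_gt]
  have hsize : (G.alloc new Js).size = (c.alloc new).next := by
    simp [Layout.alloc, Config.alloc, hG.size_eq]
  have hle : c.next ≤ (c.alloc new).next := Nat.le_add_right _ _
  refine ⟨hsize, hG.pos.trans_le hle, fun n => ?_, fun n => ?_, fun n => ?_, fun n => ?_,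
    fun n => ?_, fun n hn => ?_⟩
  · rcases hheap n with ⟨-, -, e₁, e₂⟩ | ⟨x, J, -, hok, e₁, e₂⟩ | ⟨-, -, e₁, e₂⟩
    · rw [e₁, e₂]; exact hG.nested n
    · rw [e₁, e₂]; exact hok.nested
    · rw [e₁, e₂]; exact (hG.nested n).lt
  · rcases hheap n with ⟨-, e, e₁, -⟩ | ⟨x, J, e, hok, e₁, -⟩ | ⟨e, e₀, e₁, -⟩
    · rw [e₁, e, hG.map_alloc new Js (hG.ptrs_lt n), hG.ptrs]
    · rw [e₁, e]
    · rw [e₁, e, hG.map_alloc new Js (hG.ptrs_lt n), hG.ptrs, e₀]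
  · rcases hheap n with ⟨-, e, e₁, -⟩ | ⟨x, J, e, hok, e₁, -⟩ | ⟨e, e₀, e₁, -⟩
    · rw [e₁, e, hG.map_alloc new Js (hG.pptrs_lt n), hG.pptrs]
    · rw [e₁, e, hok.pptrs]
    · rw [e₁, e, hG.map_alloc new Js (hG.pptrs_lt n), hG.pptrs, e₀]
  · rcases hheap n with ⟨-, e, -, -⟩ | ⟨x, J, e, hok, -, -⟩ | ⟨e, -, -, -⟩
    · rw [e]; exact fun m hm => (hG.ptrs_lt n m hm).trans_le hle
    · rw [e, ← hsize]; exact hok.ptrs_lt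
    · rw [e]; exact fun m hm => (hG.ptrs_lt n m hm).trans_le hle
  · rcases hheap n with ⟨-, e, -, -⟩ | ⟨x, J, e, hok, -, -⟩ | ⟨e, -, -, -⟩
    · rw [e]; exact fun m hm => (hG.pptrs_lt n m hm).trans_le hle
    · rw [e, ← hsize, hok.pptrs]; exact hok.ptrs_lt
    · rw [e]; exact fun m hm => (hG.pptrs_lt n m hm).trans_le hle
  · rw [← hsize] at hn
    have hn : G.size + new.length ≤ n := hn
    have : new[n - G.size]? = none := by
      rw [List.getElem?_eq_none_iff]
      omega
    simp [Layout.alloc, this, show ¬ n < G.size by omega]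

end Layout

end Alloc

/-! ### The plans of a thread that holds its locks -/

section Plans

variable {K V T : Type*} {P : Params} {G : Layout} {c : Config K V T}

/-- The new nodes of a plan fit into the layout, and its code respects the locks. -/
def PlanOk (G : Layout) (H : Set ℕ) (q : Plan K V T) : Prop :=
  ∃ Js, List.Forall₂ (NewOk (G.alloc q.new Js)) q.new Js ∧
    RunOk (G.alloc q.new Js) H q.code q.next

theorem planOk_of_new_eq_nil {H : Set ℕ} {code : List (Instr K V)} {next : Local K V}
    (h : RunOk G H code next) : PlanOk G H (⟨[], code, next⟩ : Plan K V T) :=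
  ⟨[], .nil, h.mono (Layout.extends_alloc G [] [])⟩

theorem planOk_unlockSeq {ns : List ℕ} (hns : ns.Pairwise G.Before) (hlt : ∀ n ∈ ns, n < G.size)
    {next : Local K V} (hnext : next.IsStart) :
    PlanOk G {n | n ∈ ns} (⟨[], unlockSeq ns, next⟩ : Plan K V T) :=
  planOk_of_new_eq_nil (runOk_unlockSeq (hns.imp Layout.Before.ne) hlt hnext)

section Replace

variable {G' : Layout} {ns : List ℕ} {next : Local K V} {p i n m : ℕ} {ms : List (Instr K V)}

/-- The new node `m` is linked in place of `n`, old nodes are marked, and all locks are released. -/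
theorem runOk_link_mark (hG : G.Extends G') (hns : ns.Pairwise G.Before)
    (hlt : ∀ n ∈ ns, n < G.size) (hnext : next.IsStart) (hp : p ∈ ns) (hm : m < G'.size)
    (hat : G.At p i n) (hs : G'.span m = G.span n) (hms : ∀ i ∈ ms, i.IsPlain) :
    RunOk G' {n | n ∈ ns} (linkScript P p i m ++ ms ++ unlockSeq ns) next := by
  have h := runOk_unlockSeq (G := G') (hns.imp Layout.Before.ne)
    (fun n hn => (hlt n hn).trans_le hG.1) hnext
  rw [List.append_assoc]
  exact (h.plains hms).link P hp hm (hat.mono hG) (hs.trans (hG.2 n hat.child_lt).1.symm)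

/-- Old nodes are marked, the new node `m` is linked in place of `n`, and all locks are released. -/
theorem runOk_mark_link (hG : G.Extends G') (hns : ns.Pairwise G.Before)
    (hlt : ∀ n ∈ ns, n < G.size) (hnext : next.IsStart) (hp : p ∈ ns) (hm : m < G'.size)
    (hat : G.At p i n) (hs : G'.span m = G.span n) (hms : ∀ i ∈ ms, i.IsPlain) :
    RunOk G' {n | n ∈ ns} (ms ++ linkScript P p i m ++ unlockSeq ns) next := by
  have h := runOk_unlockSeq (G := G') (hns.imp Layout.Before.ne)
    (fun n hn => (hlt n hn).trans_le hG.1) hnext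
  rw [List.append_assoc]
  exact (h.link P hp hm (hat.mono hG) (hs.trans (hG.2 n hat.child_lt).1.symm)).plains hms

end Replace

theorem before_path (hG : G.Fits c) {π : Path K} (hπ : PathOk G π) {p : ℕ} (hp : π.p = some p) :
    [π.n, p].Pairwise G.Before := by
  simpa using hG.before_parent (hπ.2 p hp).1

/-- The intervals that `alloc` gives to the new nodes. -/
theorem Layout.span_alloc {new : List (Node K V T)} {Js : List (ℚ × ℚ)} {n i : ℕ} {J : ℚ × ℚ}
    (hn : n = G.size + i) (h : Js[i]? = some J) : (G.alloc new Js).span n = J := by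
  simp [hn, Layout.alloc, Layout.allocSpan, h]

theorem Layout.map_span_alloc_pair (new : List (Node K V T)) (J₁ J₂ : ℚ × ℚ) (Js : List (ℚ × ℚ)) :
    [G.size, G.size + 1].map (G.alloc new (J₁ :: J₂ :: Js)).span = [J₁, J₂] := by
  rw [List.map_cons, List.map_cons, List.map_nil, span_alloc (n := G.size) (i := 0) rfl rfl,
    span_alloc (i := 1) rfl rfl]

/-- The nodes of the path and the sibling are locked from bottom to top and from left to right. -/
theorem lockedNodes_pairwise (hG : G.Fits c) {τ : Task K V} {π : Path K} {sib : Option ℕ}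
    (h : (Local.locked τ π sib).RestOk G) : (lockedNodes τ π sib).Pairwise G.Before := by
  obtain ⟨hπ, hl⟩ := h
  cases τ with
  | find k => exact hl.elim
  | insert k v => simp [lockedNodes]
  | delete k => simp [lockedNodes]
  | fixTagged n ret =>
    obtain ⟨-, p, gp, hp, hgp⟩ := hl
    have h₁ := hG.before_parent (hπ.2 p hp).1
    have h₂ := hG.before_parent ((hπ.2 p hp).2 gp hgp)
    simpa [lockedNodes, hp, hgp] using ⟨⟨h₁, lt_trans h₁ h₂⟩, h₂⟩
  | fixUnderfull n rest ret =>
    obtain ⟨-, p, gp, hp, hgp, hs⟩ := hl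
    have h₁ := hG.before_parent (hπ.2 p hp).1
    have h₂ := hG.before_parent ((hπ.2 p hp).2 gp hgp)
    have h₁₂ : G.Before π.n gp := lt_trans h₁ h₂
    simp only [lockedNodes, hp, hgp, underfullLocks]
    cases sib with
    | none => split <;> simp [h₁, h₂, h₁₂]
    | some s =>
      have hat := hs s rfl
      have h₃ := hG.before_parent hat
      have h₃₂ : G.Before s gp := lt_trans h₃ h₂
      split
      · rename_i h0
        have : G.Before π.n s := hG.before_sibling
          (by rw [Path.sibIdx, if_pos h0, h0]; exact Nat.one_pos) (hπ.2 p hp).1 hat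
        simp [h₁, h₂, h₁₂, h₃, h₃₂, this]
      · rename_i h0
        have : G.Before s π.n := hG.before_sibling
          (by rw [Path.sibIdx, if_neg h0]; omega) hat (hπ.2 p hp).1
        simp [h₁, h₂, h₁₂, h₃, h₃₂, this]

/-- The children of a tagged node take the place of that node among the children of its parent. -/
theorem nested_fixTagged (hG : G.Fits c) {p i n : ℕ} (hat : G.At p i n) :
    Nested (G.span p).1 (G.span p).2 (((c.heap p).ptrs.take i ++ (c.heap n).ptrs ++
      (c.heap p).ptrs.drop (i + 1)).map G.span) := by
  have h := hG.nested p
  rw [eq_take_append_cons_drop hat.slot] at h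
  have := h.replace (hG.nested n)
  simpa [List.map_take, List.map_drop, hG.ptrs] using this

/-- The new node gets the interval of the parent, and its children keep theirs. -/
theorem planFixTagged_ok (hG : G.Fits c) {n : ℕ} {ret : Option V} {π : Path K}
    {sib : Option ℕ} (h : (Local.locked (.fixTagged n ret) π sib).RestOk G) {p gp : ℕ}
    (hp : π.p = some p) (hgp : π.gp = some gp) :
    PlanOk G {m | m ∈ [n, p, gp]} (planFixTagged P c n ret π p gp) := by
  have hpw := lockedNodes_pairwise hG h
  have hlt : ∀ m ∈ lockedNodes (.fixTagged n ret) π sib, m < G.size := h.lt_size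
  obtain ⟨hπ, rfl, -⟩ := h
  simp only [lockedNodes, hp, hgp] at hpw hlt
  obtain ⟨hat, hat'⟩ := hπ.2 p hp
  have hat' := hat' gp hgp
  have hnest := nested_fixTagged hG hat
  unfold planFixTagged
  simp only [splitInternal, ← hG.size_eq]
  split
  · exact planOk_unlockSeq hpw hlt trivial
  set ps := (c.heap p).ptrs.take π.nIdx ++ (c.heap π.n).ptrs ++ (c.heap p).ptrs.drop (π.nIdx + 1)
    with hps
  have hb : ∀ m ∈ ps, m < c.next := by
    intro m hm
    simp only [hps, List.mem_append] at hm
    rcases hm with (hm | hm) | hm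
    · exact hG.ptrs_lt _ _ (List.mem_of_mem_take hm)
    · exact hG.ptrs_lt _ _ hm
    · exact hG.ptrs_lt _ _ (List.mem_of_mem_drop hm)
  split
  · refine ⟨[G.span p], .cons (newOk_mkInternal _ _ _ ?_ fun m hm => ?_) .nil, ?_⟩
    · rw [hG.map_alloc _ _ hb]
      exact hnest
    · exact (hG.size_eq ▸ hb m hm).trans_le (Nat.le_add_right _ _)
    · exact runOk_mark_link (Layout.extends_alloc _ _ _) hpw hlt (show Local.IsStart _ from trivial)
        (by simp) (by simp [Layout.alloc]) hat' (Layout.span_alloc (i := 0) rfl rfl)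
        (by simp [Instr.IsPlain])
  · have hnest' := hnest
    rw [← List.take_append_drop ((ps.length + 1) / 2) ps, List.map_append] at hnest'
    obtain ⟨J₁, J₂, hJ, h₁, h₂⟩ := hnest'.exists_inner₂
    have hb' : ∀ m ∈ ps, m < G.size + 3 := fun m hm =>
      (hG.size_eq ▸ hb m hm).trans_le (Nat.le_add_right _ _)
    refine ⟨[J₁, J₂, G.span p], .cons (newOk_mkInternal _ _ _ ?_ fun m hm => ?_)
      (.cons (newOk_mkInternal _ _ _ ?_ fun m hm => ?_)
        (.cons (newOk_mkInternal _ _ _ ?_ (by simp [Layout.alloc])) .nil)), ?_⟩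
    · rw [hG.map_alloc _ _ fun m hm => hb m (List.mem_of_mem_take hm)]
      exact h₁
    · exact hb' m (List.mem_of_mem_take hm)
    · rw [hG.map_alloc _ _ fun m hm => hb m (List.mem_of_mem_drop hm)]
      exact h₂
    · exact hb' m (List.mem_of_mem_drop hm)
    · rw [Layout.map_span_alloc_pair]
      exact hJ
    · exact runOk_mark_link (Layout.extends_alloc _ _ _) hpw hlt (by split <;> trivial)
        (by simp) (by simp [Layout.alloc]) hat' (Layout.span_alloc (i := 2) rfl rfl)
        (by simp [Instr.IsPlain])

variable [LinearOrder K]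

theorem planInsert_ok (hG : G.Fits c) {π : Path K} (hπ : PathOk G π) (k : K) (v : V) :
    PlanOk G {π.n} (planInsert P c k v π) := by
  have hunlock : ∀ next : Local K V, next.IsStart →
      PlanOk G {π.n} (⟨[], [.unlock π.n], next⟩ : Plan K V T) := fun next hn => by
    simpa [unlockSeq, Set.ext_iff] using
      planOk_unlockSeq (T := T) (ns := [π.n]) (by simp) (by simpa using hπ.1) hn
  unfold planInsert
  simp only
  split
  · exact hunlock _ trivial
  · split
    · exact hunlock _ trivial
    · split
      · exact planOk_of_new_eq_nil (runOk_insertScript hπ.1 _ _ _ _ trivial)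
      · split
        · rename_i p hp
          have hb : G.Before π.n p := hG.before_parent (hπ.2 p hp).1
          have hrest : (Local.lockedParent (.insert k v) π).RestOk G := ⟨hπ, k, v, p, rfl, hp⟩
          refine planOk_of_new_eq_nil (runOk_lockSeq hrest (by simp) ?_ ?_ ?_)
          · ext n
            simp [Local.heldAtRest, hp, or_comm]
          · rintro n rfl
            simpa using hb.ne
          · rintro m rfl
            simpa using hb
        · exact hunlock _ trivial

theorem planDelete_ok {π : Path K} (hπ : PathOk G π) (k : K) :
    PlanOk G {π.n} (planDelete P c k π) := by
  have hunlock : ∀ next : Local K V, next.IsStart →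
      PlanOk G {π.n} (⟨[], [.unlock π.n], next⟩ : Plan K V T) := fun next hn => by
    simpa [unlockSeq, Set.ext_iff] using
      planOk_unlockSeq (T := T) (ns := [π.n]) (by simp) (by simpa using hπ.1) hn
  unfold planDelete
  simp only
  split
  · exact hunlock _ trivial
  · split
    · exact hunlock _ trivial
    · exact planOk_of_new_eq_nil (runOk_deleteScript hπ.1 _ _ _ (by split <;> trivial))

/-- The two halves of a full leaf get intervals inside that of the leaf, which goes to their new
parent. -/
theorem planSplit_ok (hG : G.Fits c) {π : Path K} (hπ : PathOk G π) {p : ℕ} (hp : π.p = some p)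
    (k : K) (v : V) : PlanOk G {n | n ∈ [π.n, p]} (planSplit P c k v π p) := by
  have hpw := before_path hG hπ hp
  have hat := (hπ.2 p hp).1
  have hlt : ∀ n ∈ [π.n, p], n < G.size := by simpa using ⟨hat.child_lt, hat.parent_lt⟩
  unfold planSplit
  simp only [splitLeaf, ← hG.size_eq]
  split
  · exact planOk_unlockSeq hpw hlt trivial
  · obtain ⟨J₁, J₂, hJ, h₁, h₂⟩ := Nested.exists_inner₂ (L₁ := []) (L₂ := []) (hG.nested π.n).lt
    refine ⟨[J₁, J₂, G.span π.n], ?_, ?_⟩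
    · refine .cons (newOk_mkLeaf _ _ h₁) (.cons (newOk_mkLeaf _ _ h₂) (.cons ?_ .nil))
      refine newOk_mkInternal _ _ _ ?_ (by simp [Layout.alloc])
      rw [Layout.map_span_alloc_pair]
      exact hJ
    · exact runOk_link_mark (Layout.extends_alloc _ _ _) hpw hlt (by split <;> trivial)
        (by simp) (by simp [Layout.alloc]) hat (Layout.span_alloc (i := 2) rfl rfl)
        (by simp [Instr.IsPlain])

/-- Two adjacent intervals may be joined. -/
theorem Nested.merge {L₁ L₂ Sl Sr : List (ℚ × ℚ)} {Jl Jr : ℚ × ℚ} {A B : ℚ}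
    (h : Nested A B (L₁ ++ Jl :: Jr :: L₂)) (hl : Nested Jl.1 Jl.2 Sl) (hr : Nested Jr.1 Jr.2 Sr) :
    Nested A B (L₁ ++ (Jl.1, Jr.2) :: L₂) ∧ Nested Jl.1 Jr.2 (Sl ++ Sr) := by
  obtain ⟨h₁, h₂, h₃, h₄, h₅⟩ := nested_append_cons.1 h
  exact ⟨nested_append_cons.2 ⟨h₁, h₂.trans (h₃.trans h₄), h₅⟩,
    hl.append (hr.mono_left h₃.le)⟩

/-- The intervals of the two adjacent siblings are joined.  The joined interval goes to the merged
node, or it is cut anew for two new siblings; the new parent gets the interval of the old one. -/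
theorem planFixUnderfull_ok (hG : G.Fits c) {n : ℕ} {rest : List ℕ} {ret : Option V} {π : Path K}
    {sib : Option ℕ} (h : (Local.locked (.fixUnderfull n rest ret) π sib).RestOk G) {p gp : ℕ}
    (hp : π.p = some p) (hgp : π.gp = some gp) :
    PlanOk G {m | m ∈ underfullLocks π sib p gp}
      (planFixUnderfull P c n rest ret π sib p gp) := by
  have hpw := lockedNodes_pairwise hG h
  have hlt : ∀ m ∈ lockedNodes (.fixUnderfull n rest ret) π sib, m < G.size := h.lt_size
  obtain ⟨hπ, rfl, p', gp', hp', hgp', hs⟩ := h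
  obtain rfl : p = p' := Option.some.inj (hp.symm.trans hp')
  obtain rfl : gp = gp' := Option.some.inj (hgp.symm.trans hgp')
  simp only [lockedNodes, hp, hgp] at hpw hlt
  obtain ⟨hat, hat'⟩ := hπ.2 p hp
  have hat' := hat' gp hgp
  have hgpmem : gp ∈ underfullLocks π sib p gp := mem_underfullLocks.2 (by simp)
  unfold planFixUnderfull
  cases sib with
  | none =>
    simp only
    split
    · exact planOk_unlockSeq hpw hlt (finish_isStart _ _)
    · exact planOk_unlockSeq hpw hlt trivial
  | some s =>
    have hats := hs s rfl
    obtain ⟨nl, nr, j, hl, hr, hj, hatl, hatr⟩ : ∃ nl nr j,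
        (if π.nIdx = 0 then c.heap π.n else c.heap s) = c.heap nl ∧
        (if π.nIdx = 0 then c.heap s else c.heap π.n) = c.heap nr ∧
        (if π.nIdx = 0 then 0 else π.nIdx - 1) = j ∧ G.At p j nl ∧ G.At p (j + 1) nr := by
      by_cases h0 : π.nIdx = 0
      · rw [Path.sibIdx, if_pos h0] at hats
        rw [h0] at hat
        exact ⟨π.n, s, 0, if_pos h0, if_pos h0, if_pos h0, hat, hats⟩
      · rw [Path.sibIdx, if_neg h0] at hats
        have : π.nIdx - 1 + 1 = π.nIdx := by omega
        exact ⟨s, π.n, π.nIdx - 1, if_neg h0, if_neg h0, if_neg h0, hats, this ▸ hat⟩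
    simp only [hl, hr, hj, splitLeaf, splitInternal, ← hG.size_eq]
    have hn := hG.nested p
    rw [eq_take_append_cons_cons_drop hatl.slot hatr.slot] at hn
    obtain ⟨hmerge, hinner⟩ := hn.merge (hG.nested nl) (hG.nested nr)
    rw [← hG.ptrs nl, ← hG.ptrs nr, ← List.map_append] at hinner
    set ps := (c.heap nl).ptrs ++ (c.heap nr).ptrs with hps
    have hb : ∀ m ∈ ps, m < c.next := by
      intro m hm
      simp only [hps, List.mem_append] at hm
      exact hm.elim (hG.ptrs_lt _ _) (hG.ptrs_lt _ _)
    have hps' : ∀ {new : List (Node K V T)} {Js : List (ℚ × ℚ)}, ∀ m ∈ ps,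
        m < (G.alloc new Js).size := fun m hm =>
      (hG.size_eq ▸ hb m hm).trans_le (Nat.le_add_right _ _)
    have hmap : ∀ (new : List (Node K V T)) (Js : List (ℚ × ℚ)) (ms : List ℕ),
        ((c.heap p).ptrs.take j ++ ms ++ (c.heap p).ptrs.drop (j + 2)).map (G.alloc new Js).span =
          (G.slots p).take j ++ ms.map (G.alloc new Js).span ++ (G.slots p).drop (j + 2) := by
      intro new Js ms
      rw [List.map_append, List.map_append, List.map_take, List.map_drop,
        hG.map_alloc new Js (hG.ptrs_lt p), hG.ptrs]
    have hlt' : ∀ (new : List (Node K V T)) (Js : List (ℚ × ℚ)) (ms : List ℕ),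
        (∀ m ∈ ms, m < (G.alloc new Js).size) →
        ∀ m ∈ (c.heap p).ptrs.take j ++ ms ++ (c.heap p).ptrs.drop (j + 2),
          m < (G.alloc new Js).size := by
      intro new Js ms hms m hm
      simp only [List.mem_append] at hm
      rcases hm with (hm | hm) | hm
      · exact (hG.size_eq ▸ hG.ptrs_lt _ _ (List.mem_of_mem_take hm)).trans_le
          (Nat.le_add_right _ _)
      · exact hms m hm
      · exact (hG.size_eq ▸ hG.ptrs_lt _ _ (List.mem_of_mem_drop hm)).trans_le
          (Nat.le_add_right _ _)
    split
    · exact planOk_unlockSeq hpw hlt (finish_isStart _ _)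
    split
    · exact planOk_unlockSeq hpw hlt trivial
    split
    · -- the contents are shared by two new siblings
      by_cases hk : (c.heap π.n).kind = .leaf
      · simp only [if_pos hk]
        obtain ⟨J₁, J₂, hJ, h₁, h₂⟩ := Nested.exists_inner₂ (L₁ := []) (L₂ := []) hinner.lt
        refine ⟨[J₁, J₂, G.span p], .cons (newOk_mkLeaf _ _ h₁) (.cons (newOk_mkLeaf _ _ h₂)
          (.cons (newOk_mkInternal _ _ _ ?_ (hlt' _ _ _ (by simp [Layout.alloc]))) .nil)), ?_⟩
        · rw [hmap, Layout.map_span_alloc_pair]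
          exact hmerge.replace hJ
        · exact runOk_link_mark (Layout.extends_alloc _ _ _) hpw hlt (finish_isStart _ _)
            hgpmem (by simp [Layout.alloc]) hat' (Layout.span_alloc (i := 2) rfl rfl)
            (by simp [Instr.IsPlain])
      · simp only [if_neg hk]
        have hinner' := hinner
        rw [← List.take_append_drop ((ps.length + 1) / 2) ps, List.map_append] at hinner'
        obtain ⟨J₁, J₂, hJ, h₁, h₂⟩ := hinner'.exists_inner₂
        refine ⟨[J₁, J₂, G.span p],
          .cons (newOk_mkInternal _ _ _ ?_ fun m hm => hps' m (List.mem_of_mem_take hm))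
          (.cons (newOk_mkInternal _ _ _ ?_ fun m hm => hps' m (List.mem_of_mem_drop hm))
          (.cons (newOk_mkInternal _ _ _ ?_ (hlt' _ _ _ (by simp [Layout.alloc]))) .nil)), ?_⟩
        · rw [hG.map_alloc _ _ fun m hm => hb m (List.mem_of_mem_take hm)]
          exact h₁
        · rw [hG.map_alloc _ _ fun m hm => hb m (List.mem_of_mem_drop hm)]
          exact h₂
        · rw [hmap, Layout.map_span_alloc_pair]
          exact hmerge.replace hJ
        · exact runOk_link_mark (Layout.extends_alloc _ _ _) hpw hlt (finish_isStart _ _)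
            hgpmem (by simp [Layout.alloc]) hat' (Layout.span_alloc (i := 2) rfl rfl)
            (by simp [Instr.IsPlain])
    · -- the merged node `x`
      have hx : ∀ {new : List (Node K V T)} {Js : List (ℚ × ℚ)} {J : ℚ × ℚ} (d : K)
          (l : List (K × Option V)) (ks : List K), Nested J.1 J.2 (ps.map G.span) →
          NewOk (G.alloc new Js) (if (c.heap π.n).kind = .leaf then mkLeaf d l
            else mkInternal .internal d ks ps : Node K V T) J := by
        intro new Js J d l ks hJ
        split
        · exact newOk_mkLeaf _ _ hJ.lt
        · refine newOk_mkInternal _ _ _ ?_ hps'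
          rwa [hG.map_alloc _ _ hb]
      split
      · -- it becomes the root and gets the interval of the old root
        refine ⟨[G.span p], .cons (hx _ _ _ ?_) .nil, ?_⟩
        · refine (hmerge.replace hinner).sublist ?_
          rw [List.append_assoc]
          exact (List.sublist_append_left _ _).trans (List.sublist_append_right _ _)
        · exact runOk_link_mark (Layout.extends_alloc _ _ _) hpw hlt (finish_isStart _ _)
            hgpmem (by simp [Layout.alloc]) hat' (Layout.span_alloc (i := 0) rfl rfl)
            (by simp [Instr.IsPlain])
      · refine ⟨[((G.span nl).1, (G.span nr).2), G.span p], .cons (hx _ _ _ hinner) (.cons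
          (newOk_mkInternal _ _ _ ?_ (hlt' _ _ _ (by simp [Layout.alloc]))) .nil), ?_⟩
        · rw [hmap, List.map_singleton, Layout.span_alloc (n := G.size) (i := 0) rfl rfl]
          simpa using hmerge
        · exact runOk_link_mark (Layout.extends_alloc _ _ _) hpw hlt
            (show Local.IsStart _ from trivial) hgpmem (by simp [Layout.alloc]) hat'
            (Layout.span_alloc (i := 1) rfl rfl) (by simp [Instr.IsPlain])

theorem planLocked_ok (hG : G.Fits c) {τ : Task K V} {π : Path K} {sib : Option ℕ}
    (h : (Local.locked τ π sib).RestOk G) :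
    PlanOk G {n | n ∈ lockedNodes τ π sib} (planLocked P c τ π sib) := by
  cases τ with
  | find k => exact h.2.elim
  | insert k v => simpa [lockedNodes, planLocked] using planInsert_ok hG h.1 k v
  | delete k => simpa [lockedNodes, planLocked] using planDelete_ok h.1 k
  | fixTagged n ret =>
    obtain ⟨hn, p, gp, hp, hgp⟩ := h.2
    subst hn
    simp only [lockedNodes, planLocked, hp, hgp]
    exact planFixTagged_ok hG h hp hgp
  | fixUnderfull n rest ret =>
    obtain ⟨p, gp, hp, hgp, -⟩ := h.2.2
    simp only [lockedNodes, planLocked, hp, hgp]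
    exact planFixUnderfull_ok hG h hp hgp

theorem planLockedParent_ok (hG : G.Fits c) {τ : Task K V} {π : Path K}
    (h : (Local.lockedParent τ π).RestOk G) :
    PlanOk G (Local.lockedParent τ π).heldAtRest (planLockedParent P c τ π) := by
  obtain ⟨hπ, k, v, p, rfl, hp⟩ := h
  simp only [planLockedParent, hp]
  simpa [Local.heldAtRest, hp] using planSplit_ok hG hπ hp k v

end Plans

/-! ### Invariance -/

section Invariance

variable {K V T : Type*}

theorem set_eq_self_of_getElem? {α : Type*} {L : List α} {i : ℕ} {a : α}
    (h : ∀ b, L[i]? = some b → b = a) : L.set i a = L := by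
  rcases lt_or_ge i L.length with hi | hi
  · rw [← h _ (List.getElem?_eq_getElem hi), List.set_getElem_self]
  · exact List.set_eq_of_length_le hi

namespace Layout

variable {G : Layout} {c c' : Config K V T}

/-- The child pointers change, but their intervals do not. -/
theorem Fits.congr (hG : G.Fits c) (hnext : c'.next = c.next)
    (hp : ∀ n, (c'.heap n).ptrs.map G.span = G.slots n ∧ ∀ m ∈ (c'.heap n).ptrs, m < c.next)
    (hpp : ∀ n, (c'.heap n).pptrs.map G.span = G.slots n ∧ ∀ m ∈ (c'.heap n).pptrs, m < c.next) :
    G.Fits c' :=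
  ⟨hnext ▸ hG.size_eq, hnext ▸ hG.pos, hG.nested, fun n => (hp n).1, fun n => (hpp n).1,
    hnext ▸ fun n => (hp n).2, hnext ▸ fun n => (hpp n).2, hnext ▸ hG.slots_eq_nil⟩

theorem Fits.goto [DecidableEq T] (hG : G.Fits c) (t : T) (l : Local K V) : G.Fits (c.goto t l) :=
  hG.congr rfl (fun n => ⟨hG.ptrs n, hG.ptrs_lt n⟩) fun n => ⟨hG.pptrs n, hG.pptrs_lt n⟩

theorem Fits.modify (hG : G.Fits c) (n : ℕ) (f : Node K V T → Node K V T)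
    (hp : (f (c.heap n)).ptrs.map G.span = G.slots n ∧ ∀ m ∈ (f (c.heap n)).ptrs, m < c.next)
    (hpp : (f (c.heap n)).pptrs.map G.span = G.slots n ∧ ∀ m ∈ (f (c.heap n)).pptrs, m < c.next) :
    G.Fits (c.modify n f) := by
  refine hG.congr rfl (fun k => ?_) fun k => ?_
  · rcases eq_or_ne k n with rfl | hk
    · simpa [Config.modify] using hp
    · simpa [Config.modify, hk] using ⟨hG.ptrs k, hG.ptrs_lt k⟩
  · rcases eq_or_ne k n with rfl | hk
    · simpa [Config.modify] using hpp
    · simpa [Config.modify, hk] using ⟨hG.pptrs k, hG.pptrs_lt k⟩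

theorem Fits.modify_of_eq (hG : G.Fits c) (n : ℕ) (f : Node K V T → Node K V T)
    (hp : ∀ x, (f x).ptrs = x.ptrs) (hpp : ∀ x, (f x).pptrs = x.pptrs) : G.Fits (c.modify n f) :=
  hG.modify n f (by rw [hp]; exact ⟨hG.ptrs n, hG.ptrs_lt n⟩)
    (by rw [hpp]; exact ⟨hG.pptrs n, hG.pptrs_lt n⟩)

theorem map_set {L : List ℕ} {S : List (ℚ × ℚ)} (hL : L.map G.span = S) {N : ℕ}
    (hlt : ∀ m ∈ L, m < N) {i m : ℕ} (hm : m < N) (hS : ∀ J, S[i]? = some J → J = G.span m) :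
    (L.set i m).map G.span = S ∧ ∀ k ∈ L.set i m, k < N := by
  refine ⟨by rw [List.map_set, hL, set_eq_self_of_getElem? hS], fun k hk => ?_⟩
  rcases List.mem_or_eq_of_mem_set hk with hk | rfl
  exacts [hlt k hk, hm]

theorem Fits.flush (hG : G.Fits c) (l : Loc) : G.Fits (c.flush l) := by
  unfold Config.flush
  cases l with
  | key n i => refine hG.modify_of_eq n _ ?_ ?_ <;> exact fun _ => rfl
  | val n i => refine hG.modify_of_eq n _ ?_ ?_ <;> exact fun _ => rfl
  | ptr n i =>
    refine hG.modify n _ ?_ ?_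
    · exact ⟨hG.ptrs n, hG.ptrs_lt n⟩
    rcases hm : (c.heap n).ptrs[i]? with _ | m
    · simpa [hm] using ⟨hG.pptrs n, hG.pptrs_lt n⟩
    · simp only [Option.elim_some]
      refine map_set (hG.pptrs n) (hG.pptrs_lt n)
        (hG.ptrs_lt n m (List.mem_of_getElem? hm)) fun J hJ => ?_
      rw [(hG.at hm).slot] at hJ
      exact (Option.some.inj hJ).symm

theorem Fits.recover (hG : G.Fits c) (P : Params) : G.Fits (c.recover P) :=
  hG.congr rfl (fun n => ⟨hG.pptrs n, hG.pptrs_lt n⟩) fun n => ⟨hG.pptrs n, hG.pptrs_lt n⟩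

theorem Fits.exec (hG : G.Fits c) (t : T) {i : Instr K V} {is : List (Instr K V)} {H : Set ℕ}
    (hc : CodeOk G H (i :: is)) : G.Fits (i.exec t c) := by
  unfold Instr.exec
  cases i with
  | await n => exact hG
  | flush l => exact hG.flush l
  | setPtr n i m d =>
    obtain ⟨⟨-, hm, hJ, -⟩, -⟩ := hc
    refine hG.modify n _ ?_ ?_
    · exact map_set (hG.ptrs n) (hG.ptrs_lt n) (hG.size_eq ▸ hm) hJ
    · exact ⟨hG.pptrs n, hG.pptrs_lt n⟩
  | _ n => refine hG.modify_of_eq n _ ?_ ?_ <;> exact fun _ => rfl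

end Layout

theorem exec_threads (t : T) (c : Config K V T) (i : Instr K V) :
    (i.exec t c).threads = c.threads := by
  cases i with
  | flush l => cases l <;> rfl
  | _ => rfl

/-- The invariant of all configurations. -/
structure Inv (c : Config K V T) (G : Layout) : Prop where
  fits : G.Fits c
  lock : LockInv c.heap c.threads
  ok : ∀ t, (c.threads t).Ok G

variable {c : Config K V T} {G : Layout}

theorem Inv.lt_size (h : Inv c G) {t : T} {n : ℕ} (ht : t ∈ (c.heap n).queue) : n < G.size :=
  ((h.lock.mem t n).1 ht).elim ((h.ok t).lt_size n) (h.ok t).awaited_lt_size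

theorem mem_queue_of_holds {t : T} {n : ℕ} (ht : Holds c t n) : t ∈ (c.heap n).queue :=
  List.mem_of_head? ht

/-- A thread that waits for a lock holds only locks of nodes that come before. -/
theorem Inv.before_of_holds (h : Inv c G) {t : T} {n m : ℕ} (ht : t ∈ (c.heap n).queue)
    (hn : ¬ Holds c t n) (hm : Holds c t m) : G.Before m n := by
  have hw : awaited (c.threads t).code = some n :=
    ((h.lock.mem t n).1 ht).resolve_left fun hh => hn (h.lock.head t n hh)
  have hheld : m ∈ (c.threads t).held := by
    refine ((h.lock.mem t m).1 (mem_queue_of_holds hm)).resolve_right fun hw' => hn ?_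
    obtain rfl : n = m := Option.some.inj (hw.symm.trans hw')
    exact hm
  obtain ⟨is, next, e, hc, -⟩ | ⟨-, -, e⟩ := (h.ok t).cases
  · rw [e] at hw hheld
    match is with
    | .await k :: is =>
      obtain rfl : k = n := by simpa [awaited] using hw
      exact hc.1.2.2.1 m hheld.1 hheld.2
  · rw [e] at hw
    cases hw

theorem pathOk_start (hG : G.Fits c) (key : K) : PathOk G ⟨key, none, none, 0, entry, 0⟩ :=
  ⟨hG.size_eq ▸ hG.pos, by simp⟩

theorem isUpdate_of_scansOnce {P : Params} {τ : Task K V} (h : scansOnce P τ = true) :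
    τ.IsUpdate := by
  cases τ <;> simp_all [scansOnce, Task.IsUpdate]

/-- The layout of the initial configuration: the interval of the leaf is nested in that of the
sentinel. -/
def initLayout : Layout where
  size := 2
  span := fun n => if n = entry then (0, 3) else (1, 2)
  slots := fun n => if n = entry then [(1, 2)] else []

theorem inv_init (k₀ : K) : Inv (Config.init k₀ : Config K V T) initLayout where
  fits := by
    refine ⟨rfl, Nat.two_pos, fun n => ?_, fun n => ?_, fun n => ?_, fun n => ?_, fun n => ?_,
      fun n hn => ?_⟩
    · rcases eq_or_ne n entry with rfl | hn
      · norm_num [initLayout, Nested]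
      · simp only [initLayout, if_neg hn, Nested]
        norm_num
    · rcases eq_or_ne n entry with rfl | hn
      · simp [initLayout, Config.init, mkInternal]
      · simp [initLayout, Config.init, hn, mkLeaf]
    · rcases eq_or_ne n entry with rfl | hn
      · simp [initLayout, Config.init, mkInternal]
      · simp [initLayout, Config.init, hn, mkLeaf]
    · rcases eq_or_ne n entry with rfl | hn
      · simp [Config.init, mkInternal]
      · simp [Config.init, hn, mkLeaf]
    · rcases eq_or_ne n entry with rfl | hn
      · simp [Config.init, mkInternal]
      · simp [Config.init, hn, mkLeaf]
    · have hn : 2 ≤ n := hn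
      simp [initLayout, show n ≠ 0 by omega]
  lock := by
    refine .init (fun n => ?_) (fun n => ?_) (fun n => ?_) (fun _ => rfl) fun _ => rfl
    all_goals
      rcases eq_or_ne n entry with rfl | hn
      · rfl
      · simp [Config.init, hn, mkLeaf]
  ok _ := trivial

variable [DecidableEq T] {t : T}

theorem ok_update {ts : T → Local K V} (h : ∀ t, (ts t).Ok G) {l : Local K V} (hl : l.Ok G)
    (u : T) :
    (Function.update ts t l u).Ok G := by
  rcases eq_or_ne u t with rfl | hu
  · simpa using hl
  · simpa [hu] using h u

/-- A step of a thread that neither holds a lock before nor after it. -/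
theorem Inv.goto_free (h : Inv c G) {l : Local K V} (hh : (c.threads t).held = ∅)
    (hc : (c.threads t).code = []) (hl : l.Ok G) (hlh : l.held = ∅)
    (hlc : awaited l.code = none) : Inv (c.goto t l) G where
  fits := h.fits.goto t l
  lock := h.lock.goto (by rw [hh, hlh]) (by rw [hc, hlc]; rfl) (by simp [hh]) (by simp [hc])
  ok := ok_update h.ok hl

/-- A step between states other than `run` in which the thread holds no lock. -/
theorem Inv.goto_rest (h : Inv c G) {l : Local K V} (hh : (c.threads t).held = ∅)
    (hc : (c.threads t).code = []) (hl : l.RestOk G) (hlh : l.heldAtRest = ∅) :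
    Inv (c.goto t l) G := by
  obtain ⟨e₁, e₂, e₃⟩ := hl.held_eq
  exact h.goto_free hh hc e₃ (e₁.trans hlh) (by rw [e₂]; rfl)

theorem Inv.goto_start (h : Inv c G) {l : Local K V} (hh : (c.threads t).held = ∅)
    (hc : (c.threads t).code = []) (hl : l.IsStart) : Inv (c.goto t l) G :=
  h.goto_rest hh hc hl.rest.1 (hl.rest (G := G)).2

/-- A thread that holds no lock starts to lock the nodes it needs. -/
theorem Inv.goto_lock (h : Inv c G) (hh : (c.threads t).held = ∅) (hc : (c.threads t).code = [])
    {τ : Task K V} {π : Path K} {sib : Option ℕ} (hl : (Local.locked τ π sib).RestOk G) :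
    Inv (c.goto t (.run (lockSeq (lockedNodes τ π sib)) (.locked τ π sib))) G := by
  have := runOk_lockSeq (H := ∅) hl (lockedNodes_pairwise h.fits hl)
    (by simp [Local.heldAtRest]) (by simp) (by simp)
  exact h.goto_free hh hc ⟨this.code_ok, hl⟩ this.held this.awaited_eq

/-- A thread that has its locks carries out its plan. -/
theorem Inv.goto_plan (h : Inv c G) (hc : (c.threads t).code = []) {q : Plan K V T}
    (hq : PlanOk G (c.threads t).held q) :
    ∃ G', G.Extends G' ∧ Inv ((c.alloc q.new).goto t (.run q.code q.next)) G' := by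
  obtain ⟨Js, hJs, hrun⟩ := hq
  refine ⟨G.alloc q.new Js, G.extends_alloc _ _, (h.fits.alloc hJs).goto _ _, ?_, ?_⟩
  · refine LockInv.goto (ts := c.threads) (heap := (c.alloc q.new).heap)
      (h.lock.alloc fun n => ?_) hrun.held
      (by rw [hc]; exact hrun.awaited_eq) (fun n _ => ?_) (by simp [hc])
    · rcases lt_or_ge n c.next with hn | hn
      · exact Or.inl (by simp [Config.alloc, hn])
      · rcases hx : q.new[n - c.next]? with _ | x
        · exact Or.inl (by simp [Config.alloc, hx])
        · right
          obtain ⟨hi, rfl⟩ := List.getElem?_eq_some_iff.1 hx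
          have hnew := hJs.get hi (hJs.length_eq ▸ hi)
          have hheap : (c.alloc q.new).heap n = q.new[n - c.next] := by
            simp [Config.alloc, hx, hn.not_gt]
          rw [hheap]
          rw [← h.fits.size_eq] at hn
          exact ⟨fun u => ⟨fun hu => hn.not_gt ((h.ok u).lt_size n hu),
            fun hu => hn.not_gt ((h.ok u).awaited_lt_size hu)⟩, hnew.queue, hnew.ver, hnew.dirty⟩
    · rw [hc]
      exact hrun.bumps_even n
  · exact ok_update (fun u => (h.ok u).mono (G.extends_alloc _ _)) ⟨hrun.code_ok, hrun.rest_ok⟩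

theorem Inv.exec (h : Inv c G) {i : Instr K V} {is : List (Instr K V)} {next : Local K V}
    (hl : c.threads t = .run (i :: is) next) (hi : ∀ n, i ≠ .await n) :
    Inv ((i.exec t c).goto t (.run is next)) G := by
  have hok : CodeOk G next.heldAtRest (i :: is) ∧ next.RestOk G := by
    have := h.ok t
    rwa [hl] at this
  have hok' : CodeOk G next.heldAtRest is := by
    cases i with
    | request _ => exact hok.1.2
    | await _ => exact hok.1.2.2
    | unlock _ => exact hok.1.2.2
    | bumpVer _ => exact hok.1.2.2
    | setPtr _ _ _ _ => exact hok.1.2.2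
    | _ => exact hok.1.2
  refine ⟨(h.fits.exec t hok.1).goto _ _, ?_, ?_⟩
  · have := h.lock.exec hl hi hok.1
    rwa [← exec_threads t c i] at this
  · refine ok_update ?_ ⟨hok', hok.2⟩
    rw [exec_threads]
    exact h.ok

variable {P : Params}

theorem Inv.goto_afterSearch (h : Inv c G) (hh : (c.threads t).held = ∅)
    (hc : (c.threads t).code = []) {τ : Task K V} {π : Path K} (hπ : PathOk G π) :
    Inv (c.goto t (afterSearch τ π)) G := by
  cases τ with
  | fixTagged n ret =>
    unfold afterSearch
    simp only
    split
    · exact h.goto_start hh hc (return_isStart _)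
    · rename_i hn
      split
      · rename_i p gp hp hgp
        have := h.goto_lock (t := t) hh hc (τ := .fixTagged n ret) (π := π) (sib := none)
          ⟨hπ, not_not.1 hn, p, gp, hp, hgp⟩
        simpa [lockedNodes, hp, hgp] using this
      · exact h.goto_start hh hc trivial
  | fixUnderfull n rest ret =>
    unfold afterSearch
    simp only
    split
    · exact h.goto_start hh hc (return_isStart _)
    · rename_i hn
      exact h.goto_rest hh hc (show (Local.readSibling _ π).RestOk G from
        ⟨hπ, rest, ret, by rw [not_not.1 hn]⟩) rfl
  | _ => exact h.goto_rest hh hc (show (Local.leafVer _ π).RestOk G from hπ) rfl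

theorem Inv.goto_getLeaf (h : Inv c G) (hh : (c.threads t).held = ∅)
    (hc : (c.threads t).code = []) {τ : Task K V} {π : Path K} (hπ : PathOk G π)
    (hτ : τ.IsUpdate) : Inv (c.goto t (getLeaf P τ π)) G := by
  unfold getLeaf
  split
  · exact h.goto_rest hh hc (show (Local.elimStart τ π).RestOk G from ⟨hτ, hπ⟩) rfl
  · cases τ with
    | insert k v =>
      simpa [lockedNodes] using h.goto_lock (t := t) hh hc (τ := .insert k v) (π := π) (sib := none)
        ⟨hπ, trivial⟩
    | delete k =>
      simpa [lockedNodes] using h.goto_lock (t := t) hh hc (τ := .delete k) (π := π) (sib := none)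
        ⟨hπ, trivial⟩
    | _ => exact hτ.elim

theorem Inv.goto_afterScan (h : Inv c G) (hh : (c.threads t).held = ∅)
    (hc : (c.threads t).code = []) {τ : Task K V} {π : Path K} (hπ : PathOk G π)
    (found : Option V) : Inv (c.goto t (afterScan P τ π found)) G := by
  cases τ with
  | insert k v =>
    unfold afterScan
    simp only
    split
    · exact h.goto_start hh hc trivial
    · exact h.goto_getLeaf hh hc hπ trivial
  | delete k =>
    unfold afterScan
    simp only
    split
    · exact h.goto_getLeaf hh hc hπ trivial
    · exact h.goto_start hh hc trivial
  | _ => exact h.goto_start hh hc trivial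

theorem Inv.goto_retryStep (h : Inv c G) (hh : (c.threads t).held = ∅)
    (hc : (c.threads t).code = []) (τ : Task K V) : Inv (c.goto t (retryStep c τ)) G := by
  have hs : ∀ key, Inv (c.goto t (startSearch τ key)) G := fun key =>
    h.goto_rest hh hc (show (Local.search τ _).RestOk G from pathOk_start h.fits key) rfl
  cases τ with
  | fixTagged n ret =>
    unfold retryStep
    simp only
    split
    · exact h.goto_start hh hc trivial
    · exact hs _
  | _ => exact hs _

variable [LinearOrder K]

theorem Inv.of_threadStep (h : Inv c G) {c' : Config K V T}
    (hstep : threadStep P t c = some c') : ∃ G', G.Extends G' ∧ Inv c' G' := by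
  have hok := h.ok t
  have same : Inv c' G → ∃ G', G.Extends G' ∧ Inv c' G' := fun h => ⟨G, .refl G, h⟩
  unfold threadStep at hstep
  split at hstep <;> rename_i hl <;> rw [hl] at hok
  case h_1 => cases hstep
  case h_15 next =>
    -- the code is finished
    obtain rfl := Option.some.inj hstep
    obtain ⟨e₁, e₂, e₃⟩ := hok.2.held_eq
    refine same ⟨h.fits.goto _ _, h.lock.goto ?_ ?_ ?_ ?_, ok_update h.ok e₃⟩
    · rw [hl, e₁]; rfl
    · rw [hl, e₂]; rfl
    · simp [hl, e₂]
    · simp [hl]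
  case h_16 n is next =>
    split at hstep
    · rename_i hn
      obtain rfl := Option.some.inj hstep
      exact same ⟨h.fits.goto _ _, h.lock.await hl hok.1 hn, ok_update h.ok ⟨hok.1.2.2, hok.2⟩⟩
    · cases hstep
  case h_17 i is next hi =>
    obtain rfl := Option.some.inj hstep
    refine same (h.exec hl fun n e => ?_)
    subst e
    exact hi n rfl
  case h_18 τ π sib =>
    obtain rfl := Option.some.inj hstep
    exact h.goto_plan (by rw [hl]; rfl) (by rw [hl]; exact planLocked_ok h.fits hok)
  case h_19 τ π =>
    obtain rfl := Option.some.inj hstep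
    exact h.goto_plan (by rw [hl]; rfl) (by rw [hl]; exact planLockedParent_ok h.fits hok)
  all_goals
    have hh : (c.threads t).held = ∅ := by rw [hl]; rfl
    have hc : (c.threads t).code = [] := by rw [hl]; rfl
  case h_2 τ =>
    obtain rfl := Option.some.inj hstep
    refine same (h.goto_start hh hc ?_)
    unfold enterStep
    split
    · split
      · exact return_isStart _
      · trivial
    · trivial
  case h_3 τ =>
    obtain rfl := Option.some.inj hstep
    exact same (h.goto_retryStep hh hc τ)
  case h_4 τ π =>
    obtain ⟨l, hs, rfl⟩ := Option.map_eq_some_iff.1 hstep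
    unfold searchStep at hs
    simp only at hs
    split at hs
    · obtain rfl := Option.some.inj hs
      exact same (h.goto_afterSearch hh hc hok)
    · split at hs
      · cases hs
      · split at hs
        · rename_i m hm
          obtain rfl := Option.some.inj hs
          refine same (h.goto_rest hh hc (show (Local.search τ _).RestOk G from ?_) rfl)
          have hat := h.fits.at hm
          refine ⟨hat.child_lt, fun p hp => ?_⟩
          obtain rfl := Option.some.inj hp
          exact ⟨hat, fun gp hgp => (hok.2 gp hgp).1⟩
        · obtain rfl := Option.some.inj hs
          exact same (h.goto_start hh hc trivial)
  case h_5 τ π =>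
    simp only at hstep
    split at hstep <;> obtain rfl := Option.some.inj hstep
    · exact same (h.goto_rest hh hc (show (Local.leafVer τ π).RestOk G from hok) rfl)
    · exact same (h.goto_rest hh hc (show (Local.leafScan τ π _ _).RestOk G from hok) rfl)
  case h_6 τ π v₁ i =>
    split at hstep
    · split at hstep <;> obtain rfl := Option.some.inj hstep
      · exact same (h.goto_rest hh hc (show (Local.leafVal τ π _ _).RestOk G from hok) rfl)
      · exact same (h.goto_rest hh hc (show (Local.leafScan τ π _ _).RestOk G from hok) rfl)
    · obtain rfl := Option.some.inj hstep
      exact same (h.goto_rest hh hc (show (Local.leafCheck τ π _ _).RestOk G from hok) rfl)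
  case h_7 τ π v₁ i =>
    obtain rfl := Option.some.inj hstep
    exact same (h.goto_rest hh hc (show (Local.leafCheck τ π _ _).RestOk G from hok) rfl)
  case h_8 τ π v₁ found =>
    split at hstep
    · obtain rfl := Option.some.inj hstep
      exact same (h.goto_afterScan hh hc hok found)
    · split at hstep <;> obtain rfl := Option.some.inj hstep
      · rename_i hs
        exact same (h.goto_rest hh hc (show (Local.elimStart τ π).RestOk G from
          ⟨isUpdate_of_scansOnce hs, hok⟩) rfl)
      · exact same (h.goto_rest hh hc (show (Local.leafVer τ π).RestOk G from hok) rfl)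
  case h_9 τ π =>
    obtain rfl := Option.some.inj hstep
    exact same (h.goto_rest hh hc (show (Local.elimVer1 τ π _).RestOk G from hok) rfl)
  case h_10 τ π sv =>
    obtain rfl := Option.some.inj hstep
    exact same (h.goto_rest hh hc (show (Local.elimRead τ π _ _).RestOk G from hok) rfl)
  case h_11 τ π sv v₁ =>
    obtain rfl := Option.some.inj hstep
    exact same (h.goto_rest hh hc (show (Local.elimVer2 τ π _ _ _).RestOk G from hok) rfl)
  case h_12 τ π sv v₁ r =>
    split at hstep
    · obtain rfl := Option.some.inj hstep
      exact same (h.goto_rest hh hc (show (Local.elimVer1 τ π _).RestOk G from hok) rfl)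
    · split at hstep
      · obtain rfl := Option.some.inj hstep
        exact same (h.goto_rest hh hc (show (Local.tryLock τ π _).RestOk G from hok) rfl)
      · split at hstep <;> obtain rfl := Option.some.inj hstep
        · exact same (h.goto_start hh hc (by split <;> trivial))
        · exact same (h.goto_rest hh hc (show (Local.tryLock τ π _).RestOk G from hok) rfl)
  case h_13 τ π sv =>
    split at hstep <;> obtain rfl := Option.some.inj hstep
    · rename_i hq
      obtain ⟨hτ, hπ⟩ := hok
      have hlocked : (Local.locked τ π none).RestOk G ∧
          (Local.locked τ π none).heldAtRest = {π.n} := by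
        cases τ with
        | insert k v => exact ⟨⟨hπ, trivial⟩, by simp [Local.heldAtRest, lockedNodes]⟩
        | delete k => exact ⟨⟨hπ, trivial⟩, by simp [Local.heldAtRest, lockedNodes]⟩
        | _ => exact hτ.elim
      refine same ⟨Layout.Fits.goto (Layout.Fits.modify_of_eq h.fits _ _ ?_ ?_) _ _, ?_, ?_⟩
      · exact fun _ => rfl
      · exact fun _ => rfl
      · exact h.lock.tryLock hh hc (x := { c.heap π.n with queue := [t] })
          (l := .locked τ π none) (List.isEmpty_iff.1 hq) rfl rfl rfl hlocked.2 rfl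
      · exact ok_update h.ok hlocked.1
    · exact same (h.goto_rest hh hc (show (Local.elimVer1 τ π _).RestOk G from hok) rfl)
  case h_14 τ π =>
    obtain ⟨hπ, rest, ret, rfl⟩ := hok
    split at hstep
    · rename_i p gp hp hgp
      split at hstep
      · cases hstep
      · obtain rfl := Option.some.inj hstep
        have := h.goto_lock (t := t) hh hc (τ := .fixUnderfull π.n rest ret) (π := π)
          (sib := (c.heap p).ptrs[π.sibIdx]?)
          ⟨hπ, rfl, p, gp, hp, hgp, fun s hs => h.fits.at hs⟩
        simp only [lockedNodes, hp, hgp] at this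
        exact same this
    · obtain rfl := Option.some.inj hstep
      exact same (h.goto_start hh hc trivial)

theorem Inv.of_step (h : Inv c G) {c' : Config K V T} (hstep : Step P c c') :
    ∃ G', G.Extends G' ∧ Inv c' G' := by
  cases hstep with
  | invoke t res τ idle _ =>
    exact ⟨G, .refl G, h.goto_start (by rw [idle]; rfl) (by rw [idle]; rfl) trivial⟩
  | act _ t step => exact h.of_threadStep step
  | writeBack l _ =>
    refine ⟨G, .refl G, h.fits.flush l, ?_, ?_⟩
    · have ht : (c.flush l).threads = c.threads := by cases l <;> rfl
      rw [ht]
      refine h.lock.congr ?_ ?_ ?_ <;> intro k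
      all_goals
        cases l with
        | _ n => rcases eq_or_ne k n with rfl | hk <;> simp [Config.flush, Config.modify, *]
    · cases l <;> exact h.ok
  | crash _ =>
    exact ⟨G, .refl G, h.fits.recover P, .init (fun _ => rfl) (fun _ => rfl) (fun _ => rfl)
      (fun _ => rfl) fun _ => rfl, fun _ => trivial⟩

end Invariance

/-! ### Acquisition of locks -/

section Acquire

variable {K V T : Type*} {c c' : Config K V T} {G : Layout} {t : T}

theorem Inv.before_of_acquires_of_mem (h : Inv c G) {n m : ℕ} (ha : Acquires c c' t n)
    (ht : t ∈ (c.heap n).queue) (hm : Holds c t m) :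
    m < G.size ∧ n < G.size ∧ G.Before m n :=
  ⟨h.lt_size (mem_queue_of_holds hm), h.lt_size ht, h.before_of_holds ht ha.1 hm⟩

theorem mem_queue_exec {u : T} {i : Instr K V} {n : ℕ}
    (h : t ∈ ((i.exec u c).heap n).queue) : t ∈ (c.heap n).queue ∨ t = u ∧ i = .request n := by
  cases i with
  | request k =>
    rcases eq_or_ne n k with rfl | hk
    · simpa [Instr.exec, Config.modify] using h
    · exact Or.inl (by simpa [Instr.exec, Config.modify, hk] using h)
  | unlock k =>
    rcases eq_or_ne n k with rfl | hk
    · exact Or.inl (List.mem_of_mem_tail (by simpa [Instr.exec, Config.modify] using h))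
    · exact Or.inl (by simpa [Instr.exec, Config.modify, hk] using h)
  | await k => exact Or.inl h
  | flush l =>
    left
    cases l with
    | _ k => rcases eq_or_ne n k with rfl | hk <;>
              simpa [Instr.exec, Config.flush, Config.modify, *] using h
  | _ k =>
    left
    rcases eq_or_ne n k with rfl | hk <;> simpa [Instr.exec, Config.modify, *] using h

theorem PlanOk.mem_queue {H : Set ℕ} {q : Plan K V T} (hq : PlanOk G H q) {n : ℕ}
    (h : t ∈ ((c.alloc q.new).heap n).queue) : t ∈ (c.heap n).queue := by
  obtain ⟨Js, hJs, -⟩ := hq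
  simp only [Config.alloc] at h
  split at h
  · exact h
  · rcases hx : q.new[n - c.next]? with _ | x
    · simpa [hx] using h
    · obtain ⟨hi, rfl⟩ := List.getElem?_eq_some_iff.1 hx
      have hnew := hJs.get hi (hJs.length_eq ▸ hi)
      have : q.new[n - c.next].queue = [] := hnew.queue
      simp [hx, this] at h

variable [DecidableEq T] [LinearOrder K] {P : Params}

/-- A thread gets into a lock queue only by requesting the lock, or by finding the lock free, when
it holds no lock. -/
theorem Inv.mem_queue_threadStep (h : Inv c G) {u : T} (hstep : threadStep P u c = some c') {n : ℕ}
    (ht : t ∈ (c'.heap n).queue) : t ∈ (c.heap n).queue ∨ t = u ∧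
      ((∃ is next, c.threads t = .run (.request n :: is) next) ∨ ∀ m, ¬ Holds c t m) := by
  have hok := h.ok u
  unfold threadStep at hstep
  split at hstep <;> rename_i hl <;> rw [hl] at hok
  case h_4 =>
    obtain ⟨l, -, rfl⟩ := Option.map_eq_some_iff.1 hstep
    exact Or.inl ht
  case h_5 =>
    simp only at hstep
    split at hstep <;> obtain rfl := Option.some.inj hstep <;> exact Or.inl ht
  case h_13 τ π sv =>
    split at hstep <;> obtain rfl := Option.some.inj hstep
    · rcases eq_or_ne n π.n with rfl | hn
      · right
        have : t = u := by simpa [Config.goto, Config.modify] using ht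
        subst this
        refine ⟨rfl, Or.inr fun m hm => ?_⟩
        have := (h.lock.mem t m).1 (mem_queue_of_holds hm)
        rw [hl] at this
        exact this.elim (fun h => h.elim) fun h => by cases h
      · exact Or.inl (by simpa [Config.goto, Config.modify, hn] using ht)
    · exact Or.inl ht
  case h_17 i is next hi =>
    obtain rfl := Option.some.inj hstep
    rcases mem_queue_exec (c := c) (u := u) (i := i) ht with ht | ⟨rfl, rfl⟩
    · exact Or.inl ht
    · exact Or.inr ⟨rfl, Or.inl ⟨is, next, hl⟩⟩
  case h_18 τ π sib =>
    obtain rfl := Option.some.inj hstep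
    exact Or.inl ((planLocked_ok h.fits hok).mem_queue ht)
  case h_19 τ π =>
    obtain rfl := Option.some.inj hstep
    exact Or.inl ((planLockedParent_ok h.fits hok).mem_queue ht)
  all_goals
    left
    repeat' split at hstep
    all_goals
      first
      | (obtain rfl := Option.some.inj hstep; exact ht)
      | cases hstep

/-- Locks are acquired in the order of the layout. -/
theorem Inv.before_of_acquires (h : Inv c G) (hstep : Step P c c') {n m : ℕ}
    (ha : Acquires c c' t n) (hm : Holds c t m) : m < G.size ∧ n < G.size ∧ G.Before m n := by
  have ht := mem_queue_of_holds ha.2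
  cases hstep with
  | invoke u res τ idle _ => exact h.before_of_acquires_of_mem ha ht hm
  | writeBack l _ =>
    exact h.before_of_acquires_of_mem ha
      ((mem_queue_exec (u := t) (i := (.flush l : Instr K V)) ht).resolve_right (by simp)) hm
  | crash _ => cases ht
  | act _ u step =>
    rcases h.mem_queue_threadStep step ht with ht | ⟨rfl, ⟨is, next, hl⟩ | hno⟩
    · exact h.before_of_acquires_of_mem ha ht hm
    · have hok := h.ok t
      rw [hl] at hok
      obtain ⟨⟨hreq, hc⟩, -⟩ := hok
      have hheld : m ∈ (c.threads t).held := by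
        refine ((h.lock.mem t m).1 (mem_queue_of_holds hm)).resolve_right fun hw => ?_
        rw [hl] at hw
        cases hw
      rw [hl] at hheld
      refine ⟨h.lt_size (mem_queue_of_holds hm), ?_⟩
      match is with
      | .await k :: is =>
        obtain rfl : k = n := by simpa [awaited] using hreq
        exact ⟨hc.1.1, hc.1.2.2.1 m hheld.1 hheld.2⟩
    · exact (hno m hm).elim

end Acquire

/-! ### Absence of deadlocks -/

section Waiting

variable {K V T : Type*} {P : Params} {c : Config K V T} {G : Layout} {t u : T}

theorem exists_holds {n : ℕ} (h : (c.heap n).queue ≠ []) : ∃ u, Holds c u n := by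
  obtain ⟨u, q, hq⟩ := List.exists_cons_of_ne_nil h
  exact ⟨u, by simp [Holds, hq]⟩

theorem Inv.exists_holds_of_odd (h : Inv c G) {n : ℕ} (hn : (c.heap n).ver % 2 = 1) :
    ∃ u, Holds c u n :=
  (h.lock.odd n hn).imp fun u hu => h.lock.head u n hu

theorem Inv.exists_holds_of_dirty (h : Inv c G) {n i : ℕ} (hn : (c.heap n).dirty i = true) :
    ∃ u, Holds c u n :=
  (h.lock.dirty n i hn).imp fun u hu => h.lock.head u n hu.1

theorem Inv.inProgress_of_holds (h : Inv c G) {n : ℕ} (hn : Holds c t n) : InProgress c t := by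
  intro res hl
  have := (h.lock.mem t n).1 (mem_queue_of_holds hn)
  rw [hl] at this
  exact this.elim (fun h => h.elim) fun h => by cases h

theorem idxOf_lt_of_sublist [DecidableEq T] {q : List T} (hq : q.Nodup)
    (h : List.Sublist [u, t] q) : q.idxOf u < q.idxOf t := by
  induction q with
  | nil => cases h
  | cons a q ih =>
    rw [List.nodup_cons] at hq
    cases h with
    | cons _ h =>
      have hu : a ≠ u := by rintro rfl; exact hq.1 (h.subset (by simp))
      have ht : a ≠ t := by rintro rfl; exact hq.1 (h.subset (by simp))
      rw [List.idxOf_cons_ne _ hu, List.idxOf_cons_ne _ ht]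
      exact Nat.succ_lt_succ (ih hq.2 h)
    | cons_cons _ h =>
      have ht : u ≠ t := by rintro rfl; exact hq.1 (h.subset (by simp))
      rw [List.idxOf_cons_self, List.idxOf_cons_ne _ ht]
      exact Nat.succ_pos _

variable [LinearOrder K]

/-- A thread that waits either waits for a lock or is in no queue at all. -/
theorem WaitsAt.cases {n : ℕ} (hw : WaitsAt P c t n) :
    (awaited (c.threads t).code = some n ∧ ¬ Holds c t n) ∨
      (c.threads t).held = ∅ ∧ awaited (c.threads t).code = none := by
  unfold WaitsAt at hw
  split at hw
  case h_1 hl =>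
    obtain ⟨rfl, hw⟩ := hw
    exact Or.inl ⟨by rw [hl]; rfl, hw⟩
  case h_7 => exact hw.elim
  all_goals
    rename_i hl
    exact Or.inr ⟨by rw [hl]; rfl, by rw [hl]; rfl⟩

/-- Some thread holds the lock of a node at which a thread waits. -/
theorem Inv.exists_holds_of_waitsAt (h : Inv c G) {n : ℕ} (hw : WaitsAt P c t n) :
    ∃ u, Holds c u n := by
  unfold WaitsAt at hw
  split at hw
  case h_1 m _ _ hl =>
    obtain ⟨rfl, -⟩ := hw
    exact exists_holds (List.ne_nil_of_mem ((h.lock.mem t m).2 (Or.inr (by rw [hl]; rfl))))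
  case h_2 => exact h.exists_holds_of_dirty hw.2.2
  case h_3 => exact h.exists_holds_of_dirty hw.2
  case h_4 => exact h.exists_holds_of_odd hw.2.2
  case h_5 => exact h.exists_holds_of_odd hw.2
  case h_6 => exact exists_holds hw.2
  case h_7 => exact hw.elim

/-- Along a chain of waiting threads the awaited nodes become larger in the order of the layout, and
while they stay the same the positions in the queue become smaller. -/
theorem Inv.not_deadlock [DecidableEq T] (h : Inv c G) (S : Set T) : ¬ Deadlock P c S := by
  rintro ⟨⟨t₀, ht₀⟩, hS⟩
  have hnext : ∀ t ∈ S, ∃ u ∈ S, WaitsFor P c t u := fun t ht =>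
    (hS t ht).resolve_right fun ⟨n, hw, hn⟩ =>
      let ⟨u, hu⟩ := h.exists_holds_of_waitsAt hw
      hn u hu
  -- a thread of `S` that is in a queue waits for a lock
  have hqueue : ∀ u ∈ S, ∀ n, u ∈ (c.heap n).queue →
      ∃ m, awaited (c.threads u).code = some m ∧ ¬ Holds c u m := by
    intro u hu n hn
    obtain ⟨-, -, m, hw, -⟩ := hnext u hu
    rcases hw.cases with hw | ⟨hh, hc⟩
    · exact ⟨m, hw⟩
    · have := (h.lock.mem u n).1 hn
      simp [hh, hc] at this
  let A : Set ℕ := {n | ∃ u ∈ S, awaited (c.threads u).code = some n ∧ ¬ Holds c u n}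
  have hfin : A.Finite := (Set.finite_lt_nat G.size).subset fun n ⟨u, _, hu, _⟩ =>
    (h.ok u).awaited_lt_size hu
  have hne : A.Nonempty := by
    obtain ⟨u, hu, n, hw, hn⟩ := hnext t₀ ht₀
    obtain ⟨m, hm⟩ := hqueue u hu n
      (hn.elim mem_queue_of_holds fun h => h.subset (by simp))
    exact ⟨m, u, hu, hm⟩
  obtain ⟨n, ⟨t, ht, htn⟩, hmax⟩ := hfin.exists_maximalFor (fun n => (G.span n).2) A hne
  obtain ⟨k, hk⟩ : ∃ k, (c.heap n).queue.idxOf t = k := ⟨_, rfl⟩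
  induction k using Nat.strong_induction_on generalizing t with
  | _ k ih =>
    obtain ⟨u, hu, m, hw, hum⟩ := hnext t ht
    obtain rfl : m = n := by
      rcases hw.cases with ⟨hw, -⟩ | ⟨-, hc⟩
      · exact Option.some.inj (hw.symm.trans htn.1)
      · rw [htn.1] at hc
        cases hc
    have hmem : u ∈ (c.heap m).queue :=
      hum.elim mem_queue_of_holds fun h => h.subset (by simp)
    obtain ⟨m', hm', hum'⟩ := hqueue u hu m hmem
    -- `u` holds the lock and awaits that of a later node, or it is ahead of `t` in the same queue
    by_cases hhold : Holds c u m
    · have hb := h.before_of_holds ((h.lock.mem u m').2 (Or.inr hm')) hum' hhold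
      exact hb.not_ge (hmax ⟨u, hu, hm', hum'⟩ hb.le)
    · have := ((h.lock.mem u m).1 hmem).resolve_left fun hh => hhold (h.lock.head u m hh)
      obtain rfl := Option.some.inj (hm'.symm.trans this)
      exact ih _ (hk ▸ idxOf_lt_of_sublist (h.lock.nodup _) (hum.resolve_left hhold)) u hu
        ⟨hm', hum'⟩ rfl

theorem isSome_threadStep [DecidableEq T] (hp : InProgress c t) (hw : ∀ n, ¬ WaitsAt P c t n) :
    (threadStep P t c).isSome = true := by
  unfold WaitsAt at hw
  unfold threadStep
  split <;> rename_i hl <;> simp only [hl] at hw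
  case h_1 => exact (hp _ hl).elim
  case h_4 τ π =>
    have := hw π.n
    unfold searchStep
    simp only
    split
    · rfl
    · rename_i hn
      rw [if_neg fun hd => this ⟨rfl, hn, hd⟩]
      split <;> rfl
  case h_5 τ π =>
    simp only
    split <;> rfl
  case h_14 τ π =>
    split
    · rename_i p gp hp hgp
      rw [if_neg fun hd => hw p ⟨hp, hd⟩]
      rfl
    · rfl
  case h_16 n is next =>
    rw [if_pos (by by_contra hn; exact hw n ⟨rfl, hn⟩)]
    rfl
  all_goals repeat' first | rfl | split

end Waiting

/-! ### The order of the nodes in an execution -/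

section Execution

namespace Layout

theorem Extends.trans {G₁ G₂ G₃ : Layout} (h : G₁.Extends G₂) (h' : G₂.Extends G₃) :
    G₁.Extends G₃ :=
  ⟨h.1.trans h'.1, fun n hn => ⟨((h'.2 n (hn.trans_le h.1)).1).trans (h.2 n hn).1,
    ((h'.2 n (hn.trans_le h.1)).2).trans (h.2 n hn).2⟩⟩

theorem extends_of_le {G : ℕ → Layout} (hG : ∀ i, (G i).Extends (G (i + 1))) {i j : ℕ}
    (hij : i ≤ j) : (G i).Extends (G j) := by
  induction hij with
  | refl => exact .refl _
  | step _ ih => exact ih.trans (hG _)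

/-- The right end of the interval that the node gets at any time. -/
theorem exists_limit {G : ℕ → Layout} (hG : ∀ i, (G i).Extends (G (i + 1))) :
    ∃ r : ℕ → ℚ, ∀ i, ∀ n < (G i).size, r n = ((G i).span n).2 := by
  classical
  have key : ∀ n, ∃ q : ℚ, ∀ i, n < (G i).size → q = ((G i).span n).2 := by
    intro n
    by_cases h : ∃ i, n < (G i).size
    · refine ⟨((G (Nat.find h)).span n).2, fun i hi => ?_⟩
      rw [((extends_of_le hG (Nat.find_min' h hi)).2 n (Nat.find_spec h)).1]
    · exact ⟨0, fun i hi => (h ⟨i, hi⟩).elim⟩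
  choose r hr using key
  exact ⟨r, fun i n hn => hr n i hn⟩

end Layout

variable {K V T : Type*} [LinearOrder K] [DecidableEq T] {P : Params} {k₀ : K}
  {σ : ℕ → Config K V T}

theorem IsExecution.exists_layouts (hσ : IsExecution P k₀ σ) :
    ∃ G : ℕ → Layout, (∀ i, Inv (σ i) (G i)) ∧ ∀ i, (G i).Extends (G (i + 1)) := by
  have step : ∀ i G, Inv (σ i) G → ∃ G', G.Extends G' ∧ Inv (σ (i + 1)) G' := by
    intro i G h
    rcases hσ.step i with e | hs
    · exact ⟨G, .refl G, e ▸ h⟩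
    · exact h.of_step hs
  choose f hf hf' using step
  let G : (i : ℕ) → {G : Layout // Inv (σ i) G} := fun i =>
    i.rec ⟨initLayout, hσ.init ▸ inv_init k₀⟩ fun i g => ⟨f i g.1 g.2, hf' i g.1 g.2⟩
  exact ⟨fun i => (G i).1, fun i => (G i).2, fun i => hf i (G i).1 (G i).2⟩

end Execution
end OCCABtree

/-- Deadlock freedom of the OCC-ABtree, the Elim-ABtree, the p-OCC-ABtree and the p-Elim-ABtree. -/
theorem mainTheorem6 {K V T : Type*} [LinearOrder K] [DecidableEq T] (P : Params)
    (ha : 2 ≤ P.a) (hab : 2 * P.a ≤ P.b) (k₀ : K) (σ : ℕ → Config K V T)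
    (hσ : IsExecution P k₀ σ) :
    (∀ i, ¬ ∃ S : Set T, Deadlock P (σ i) S) ∧
    (∀ i t n, Holds (σ i) t n → InProgress (σ i) t) ∧
    (∀ i t, InProgress (σ i) t → (∀ n, ¬ WaitsAt P (σ i) t n) →
      (threadStep P t (σ i)).isSome = true) ∧
    (∃ lt : ℕ → ℕ → Prop, IsStrictTotalOrder ℕ lt ∧
      (∀ i x y, Precedes (σ i) x y → lt x y) ∧
      (∀ i t n, Acquires (σ i) (σ (i + 1)) t n → ∀ m, Holds (σ i) t m → lt m n)) ∧
    (∀ i j x y, Precedes (σ i) x y → ¬ Precedes (σ j) y x) := by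
  obtain ⟨G, hG, hext⟩ := hσ.exists_layouts
  obtain ⟨r, hr⟩ := Layout.exists_limit hext
  have hlt : ∀ i x y, Precedes (σ i) x y → r x < r y := by
    intro i x y h
    obtain ⟨hx, hy, hb⟩ := (hG i).fits.before_of_precedes h
    rw [hr i x hx, hr i y hy]
    exact hb
  refine ⟨fun i ⟨S, hS⟩ => (hG i).not_deadlock S hS, fun i t n h => (hG i).inProgress_of_holds h,
    fun i t => isSome_threadStep, ?_, fun i j x y h h' => (hlt i x y h).asymm (hlt j y x h')⟩
  -- nodes whose intervals have the same right end are ordered by their references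
  let f : ℕ ↪ ℚ ×ₗ ℕ := ⟨fun n => toLex (r n, n), fun m n h => congrArg (fun p => (ofLex p).2) h⟩
  refine ⟨f ⁻¹'o (· < ·), (RelEmbedding.preimage f (· < ·)).isStrictTotalOrder, ?_, ?_⟩
  · intro i x y h
    exact Prod.Lex.toLex_lt_toLex.2 (Or.inl (hlt i x y h))
  · intro i t n h m hm
    rcases hσ.step i with e | hs
    · rw [e] at h
      exact (h.1 h.2).elim
    · obtain ⟨h₁, h₂, hb⟩ := (hG i).before_of_acquires hs h hm
      refine Prod.Lex.toLex_lt_toLex.2 (Or.inl ?_)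
      simp only
      rw [hr i m h₁, hr i n h₂]
      exact hb
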